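/- Let $M^{2n+1}$ be a smooth manifold with a contact pseudo-metric structure $(\varphi,\xi,\eta,g)$: $\varphi$ is a smooth $(1,1)$-tensor field, $\xi$ a smooth vector field, $\eta$ a smooth $1$-form, $g$ a pseudo-Riemannian metric and $\varepsilon\in\{1,-1\}$, with $\eta(\xi)=1$, $\varphi^2X=-X+\eta(X)\xi$, $g(\varphi X,\varphi Y)=g(X,Y)-\varepsilon\,\eta(X)\eta(Y)$ and $d\eta(X,Y)=g(X,\varphi Y)$, where $d\eta(X,Y)=\tfrac12\big(X\eta(Y)-Y\eta(X)-\eta([X,Y])\big)$. Let $\nabla$ be the Levi-Civita connection of $g$, $R(X,Y)=[\nabla_X,\nabla_Y]-\nabla_{[X,Y]}$ its curvature tensor, and $h=\tfrac12\mathcal L_\xi\varphi$. Suppose that $M$ is a $(\kappa,\mu)$-contact pseudo-metric manifold, i.e. that for some constants $\kappa,\mu\in\mathbb R$ and all vector fields $X,Y$ $$R(X,Y)\xi=\varepsilon\kappa\,(\eta(Y)X-\eta(X)Y)+\varepsilon\mu\,(\eta(Y)hX-\eta(X)hY).$$ Assume $\varepsilon\kappa<1$, put $\lambda=\sqrt{1-\varepsilon\kappa}$,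 and let $\mathcal D(\lambda)$ and $\mathcal D(-\lambda)$ be the eigen-distributions of $h$ for the eigenvalues $\lambda$ and $-\lambda$. Then for all $X_\lambda,Y_\lambda,Z_\lambda\in\mathcal D(\lambda)$ and $X_{-\lambda},Y_{-\lambda},Z_{-\lambda}\in\mathcal D(-\lambda)$, $$\begin{aligned} R(X_{\lambda},Y_{\lambda})Z_{-\lambda}&=(\kappa-\varepsilon\mu)\,[g(\varphi Y_{\lambda},Z_{-\lambda})\varphi X_{\lambda}-g(\varphi X_{\lambda},Z_{-\lambda})\varphi Y_{\lambda}],\\ R(X_{-\lambda},Y_{-\lambda})Z_{\lambda}&=(\kappa-\varepsilon\mu)\,[g(\varphi Y_{-\lambda},Z_{\lambda})\varphi X_{-\lambda}-g(\varphi X_{-\lambda},Z_{\lambda})\varphi Y_{-\lambda}],\\ R(X_{-\lambda},Y_{\lambda})Z_{-\lambda}&=-\kappa\, g(\varphi Y_{\lambda},Z_{-\lambda})\varphi X_{-\lambda}-\varepsilon\mu\, g(\varphi Y_{\lambda},X_{-\lambda})\varphi Z_{-\lambda},\\ R(X_{-\lambda},Y_{\lambda})Z_{\lambda}&=\kappa\,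 g(\varphi X_{-\lambda},Z_{\lambda})\varphi Y_{\lambda}+\varepsilon\mu\, g(\varphi X_{-\lambda},Y_{\lambda})\varphi Z_{\lambda},\\ R(X_{\lambda},Y_{\lambda})Z_{\lambda}&=[2(\varepsilon+\lambda)-\varepsilon\mu]\,[g(Y_{\lambda},Z_{\lambda})X_{\lambda}-g(X_{\lambda},Z_{\lambda})Y_{\lambda}],\\ R(X_{-\lambda},Y_{-\lambda})Z_{-\lambda}&=[2(\varepsilon-\lambda)-\varepsilon\mu]\,[g(Y_{-\lambda},Z_{-\lambda})X_{-\lambda}-g(X_{-\lambda},Z_{-\lambda})Y_{-\lambda}]. \end{aligned}$$ -/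

import Mathlib

open Bundle Module VectorField
open scoped Manifold ContDiff Topology

noncomputable section

namespace ContactPM

variable {E : Type*} [NormedAddCommGroup E] [NormedSpace ℝ E]
  {M : Type*} [TopologicalSpace M] [ChartedSpace E M]

/-- The derivative `X f` of the function `f` along the vector field `X`. -/
def dirDeriv (X : Π x : M, TangentSpace 𝓘(ℝ, E) x) (f : M → ℝ) (x : M) : ℝ :=
  mvfderiv 𝓘(ℝ, E) f x (X x)

theorem dirDeriv_add {X X' : Π x : M, TangentSpace 𝓘(ℝ, E) x} {f : M → ℝ} {x : M} :
    dirDeriv (X + X') f x = dirDeriv X f x + dirDeriv X' f x := by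
  simp [dirDeriv]

theorem dirDeriv_smul {X : Π x : M, TangentSpace 𝓘(ℝ, E) x} {f : M → ℝ} {x : M} (a : M → ℝ) :
    dirDeriv (a • X) f x = a x * dirDeriv X f x := by
  simp [dirDeriv]

variable [IsManifold 𝓘(ℝ, E) ∞ M]

variable (E M) in
/-- A pseudo-Riemannian metric on `M`: a smooth field of non-degenerate symmetric bilinear forms on
the tangent spaces. -/
structure PseudoMetric where
  /-- The scalar product on each tangent space. -/
  val : ∀ x : M, TangentSpace 𝓘(ℝ, E) x →L[ℝ] TangentSpace 𝓘(ℝ, E) x →L[ℝ] ℝ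
  symm : ∀ (x : M) (v w : TangentSpace 𝓘(ℝ, E) x), val x v w = val x w v
  nondegenerate : ∀ (x : M) (v : TangentSpace 𝓘(ℝ, E) x), (∀ w, val x v w = 0) → v = 0
  smooth : ContMDiff 𝓘(ℝ, E) (𝓘(ℝ, E).prod 𝓘(ℝ, E →L[ℝ] E →L[ℝ] ℝ)) ∞
    (fun x : M ↦ TotalSpace.mk' (E →L[ℝ] E →L[ℝ] ℝ)
      (E := fun x : M ↦ (TangentSpace 𝓘(ℝ, E) x →L[ℝ] TangentSpace 𝓘(ℝ, E) x →L[ℝ] ℝ)) x (val x))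

/-- The function `g(X, Y)`. -/
def PseudoMetric.pair (g : PseudoMetric E M) (X Y : Π x : M, TangentSpace 𝓘(ℝ, E) x) (x : M) : ℝ :=
  g.val x (X x) (Y x)

/-- A covariant derivative `D` on the tangent bundle (with `D Y x (X x)` for `(∇_X Y)(x)`)
is the Levi-Civita connection of `g` if it is torsion free, `∇_X Y - ∇_Y X = [X, Y]`, and metric,
`X g(Y, Z) = g(∇_X Y, Z) + g(Y, ∇_X Z)`. -/
structure IsLeviCivita (g : PseudoMetric E M)
    (D : CovariantDerivative 𝓘(ℝ, E) E (TangentSpace 𝓘(ℝ, E) : M → Type _)) : Prop where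
  torsion_free : ∀ (X Y : Π x : M, TangentSpace 𝓘(ℝ, E) x) (x : M),
    MDiffAt (T% X) x → MDiffAt (T% Y) x →
      D Y x (X x) - D X x (Y x) = mlieBracket 𝓘(ℝ, E) X Y x
  metric : ∀ (X Y Z : Π x : M, TangentSpace 𝓘(ℝ, E) x) (x : M),
    MDiffAt (T% X) x → MDiffAt (T% Y) x → MDiffAt (T% Z) x →
      dirDeriv X (g.pair Y Z) x = g.val x (D Y x (X x)) (Z x) + g.val x (Y x) (D Z x (X x))

/-! ### Existence of the Levi-Civita connection, through the Koszul formula -/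

section Existence

variable (g : PseudoMetric E M)

theorem PseudoMetric.pair_mdiff {X Y : Π x : M, TangentSpace 𝓘(ℝ, E) x} {x : M}
    (hX : MDiffAt (T% X) x) (hY : MDiffAt (T% Y) x) :
    MDifferentiableAt 𝓘(ℝ, E) 𝓘(ℝ, ℝ) (g.pair X Y) x := by
  have : MDifferentiableAt 𝓘(ℝ, E) (𝓘(ℝ, E).prod 𝓘(ℝ, ℝ))
      (fun y : M ↦ TotalSpace.mk' ℝ (E := Bundle.Trivial M ℝ) y (g.val y (X y) (Y y))) x := by
    apply MDifferentiableAt.clm_bundle_apply₂ (F₁ := E) (F₂ := E)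
    · exact g.smooth.mdifferentiableAt (by simp)
    · exact hX
    · exact hY
  simp only [mdifferentiableAt_totalSpace] at this
  exact this.2

theorem PseudoMetric.pair_comm (X Y : Π x : M, TangentSpace 𝓘(ℝ, E) x) :
    g.pair X Y = g.pair Y X := funext fun x ↦ g.symm x _ _

/-- The right-hand side of the Koszul formula for `2 g(∇_X Y, Z)`. -/
def PseudoMetric.koszul (X Y Z : Π x : M, TangentSpace 𝓘(ℝ, E) x) (x : M) : ℝ :=
  dirDeriv X (g.pair Y Z) x + dirDeriv Y (g.pair X Z) x - dirDeriv Z (g.pair X Y) x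
    + g.val x (mlieBracket 𝓘(ℝ, E) X Y x) (Z x) - g.val x (mlieBracket 𝓘(ℝ, E) X Z x) (Y x)
    - g.val x (mlieBracket 𝓘(ℝ, E) Y Z x) (X x)

variable {g} {X X' Y Y' Z Z' : Π x : M, TangentSpace 𝓘(ℝ, E) x} {x : M} {f : M → ℝ}

theorem dirDeriv_pair_add_left (hX : MDiffAt (T% X) x) (hX' : MDiffAt (T% X') x)
    (hY : MDiffAt (T% Y) x) :
    dirDeriv Z (g.pair (X + X') Y) x = dirDeriv Z (g.pair X Y) x + dirDeriv Z (g.pair X' Y) x := by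
  have h : g.pair (X + X') Y = g.pair X Y + g.pair X' Y := by
    ext y; simp [PseudoMetric.pair]
  simp only [dirDeriv, h, mvfderiv_add (g.pair_mdiff hX hY) (g.pair_mdiff hX' hY)]
  simp

theorem dirDeriv_pair_smul_left (hf : MDiffAt f x) (hX : MDiffAt (T% X) x)
    (hY : MDiffAt (T% Y) x) :
    dirDeriv Z (g.pair (f • X) Y) x
      = f x * dirDeriv Z (g.pair X Y) x + dirDeriv Z f x * g.val x (X x) (Y x) := by
  have h : g.pair (f • X) Y = f * g.pair X Y := by
    ext y; simp [PseudoMetric.pair]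
  simp only [dirDeriv, h, mvfderiv_mul hf (g.pair_mdiff hX hY)]
  simp [PseudoMetric.pair]; ring

theorem dirDeriv_pair_add_right (hX : MDiffAt (T% X) x) (hX' : MDiffAt (T% X') x)
    (hY : MDiffAt (T% Y) x) :
    dirDeriv Z (g.pair Y (X + X')) x = dirDeriv Z (g.pair Y X) x + dirDeriv Z (g.pair Y X') x := by
  rw [g.pair_comm, dirDeriv_pair_add_left hX hX' hY, g.pair_comm X, g.pair_comm X']

theorem dirDeriv_pair_smul_right (hf : MDiffAt f x) (hX : MDiffAt (T% X) x)
    (hY : MDiffAt (T% Y) x) :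
    dirDeriv Z (g.pair Y (f • X)) x
      = f x * dirDeriv Z (g.pair Y X) x + dirDeriv Z f x * g.val x (Y x) (X x) := by
  rw [g.pair_comm, dirDeriv_pair_smul_left hf hX hY, g.pair_comm X, g.symm]

theorem koszul_sub_swap : g.koszul X Y Z x - g.koszul Y X Z x
    = 2 * g.val x (mlieBracket 𝓘(ℝ, E) X Y x) (Z x) := by
  simp only [PseudoMetric.koszul]
  rw [mlieBracket_swap_apply (V := Y) (W := X), g.pair_comm Y X]
  simp
  ring

theorem koszul_add_swap : g.koszul X Y Z x + g.koszul X Z Y x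
    = 2 * dirDeriv X (g.pair Y Z) x := by
  simp only [PseudoMetric.koszul]
  rw [mlieBracket_swap_apply (V := Z) (W := Y), g.pair_comm Z Y]
  simp
  ring

variable [FiniteDimensional ℝ E]

theorem koszul_add_left (hX : MDiffAt (T% X) x) (hX' : MDiffAt (T% X') x)
    (hY : MDiffAt (T% Y) x) (hZ : MDiffAt (T% Z) x) :
    g.koszul (X + X') Y Z x = g.koszul X Y Z x + g.koszul X' Y Z x := by
  simp only [PseudoMetric.koszul]
  rw [dirDeriv_add, dirDeriv_pair_add_left hX hX' hZ, dirDeriv_pair_add_left hX hX' hY,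
    mlieBracket_add_left hX hX', mlieBracket_add_left hX hX']
  simp
  ring

theorem koszul_add_middle (hX : MDiffAt (T% X) x) (hY : MDiffAt (T% Y) x)
    (hY' : MDiffAt (T% Y') x) (hZ : MDiffAt (T% Z) x) :
    g.koszul X (Y + Y') Z x = g.koszul X Y Z x + g.koszul X Y' Z x := by
  simp only [PseudoMetric.koszul]
  rw [dirDeriv_add, dirDeriv_pair_add_left hY hY' hZ, dirDeriv_pair_add_right hY hY' hX,
    mlieBracket_add_left hY hY', mlieBracket_add_right hY hY']
  simp
  ring

theorem koszul_add_right (hX : MDiffAt (T% X) x) (hY : MDiffAt (T% Y) x)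
    (hZ : MDiffAt (T% Z) x) (hZ' : MDiffAt (T% Z') x) :
    g.koszul X Y (Z + Z') x = g.koszul X Y Z x + g.koszul X Y Z' x := by
  simp only [PseudoMetric.koszul]
  rw [dirDeriv_add, dirDeriv_pair_add_right hZ hZ' hY, dirDeriv_pair_add_right hZ hZ' hX,
    mlieBracket_add_right hZ hZ', mlieBracket_add_right hZ hZ']
  simp
  ring

theorem koszul_smul_left (hf : MDiffAt f x) (hX : MDiffAt (T% X) x)
    (hY : MDiffAt (T% Y) x) (hZ : MDiffAt (T% Z) x) :
    g.koszul (f • X) Y Z x = f x * g.koszul X Y Z x := by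
  simp only [PseudoMetric.koszul]
  rw [dirDeriv_smul, dirDeriv_pair_smul_left hf hX hZ, dirDeriv_pair_smul_left hf hX hY,
    mlieBracket_smul_left hf hX, mlieBracket_smul_left hf hX]
  simp [dirDeriv]
  ring

theorem koszul_smul_middle (hf : MDiffAt f x) (hX : MDiffAt (T% X) x)
    (hY : MDiffAt (T% Y) x) (hZ : MDiffAt (T% Z) x) :
    g.koszul X (f • Y) Z x
      = f x * g.koszul X Y Z x + 2 * (dirDeriv X f x * g.val x (Y x) (Z x)) := by
  simp only [PseudoMetric.koszul]
  rw [dirDeriv_smul, dirDeriv_pair_smul_left hf hY hZ, dirDeriv_pair_smul_right hf hY hX,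
    mlieBracket_smul_left hf hY, mlieBracket_smul_right hf hY]
  simp [dirDeriv, g.symm x (Y x) (X x)]
  ring

theorem koszul_smul_right (hf : MDiffAt f x) (hX : MDiffAt (T% X) x)
    (hY : MDiffAt (T% Y) x) (hZ : MDiffAt (T% Z) x) :
    g.koszul X Y (f • Z) x = f x * g.koszul X Y Z x := by
  simp only [PseudoMetric.koszul]
  rw [dirDeriv_smul, dirDeriv_pair_smul_right hf hZ hY, dirDeriv_pair_smul_right hf hZ hX,
    mlieBracket_smul_right hf hZ, mlieBracket_smul_right hf hZ]
  simp [dirDeriv, g.symm x (Z x) (Y x), g.symm x (Z x) (X x)]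
  ring

theorem koszul_tensorial_left (hY : MDiffAt (T% Y) x) (hZ : MDiffAt (T% Z) x) :
    TensorialAt 𝓘(ℝ, E) E (fun X ↦ g.koszul X Y Z x) x where
  smul hf hX := koszul_smul_left hf hX hY hZ
  add hX hX' := koszul_add_left hX hX' hY hZ

theorem koszul_tensorial_right (hX : MDiffAt (T% X) x) (hY : MDiffAt (T% Y) x) :
    TensorialAt 𝓘(ℝ, E) E (fun Z ↦ g.koszul X Y Z x) x where
  smul hf hZ := koszul_smul_right hf hX hY hZ
  add hZ hZ' := koszul_add_right hX hY hZ hZ'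

variable (g) in
/-- Every bilinear form on `T_x M` is represented by an endomorphism through `g`. -/
theorem exists_represent (x : M)
    (B : TangentSpace 𝓘(ℝ, E) x →L[ℝ] TangentSpace 𝓘(ℝ, E) x →L[ℝ] ℝ) :
    ∃ A : TangentSpace 𝓘(ℝ, E) x →L[ℝ] TangentSpace 𝓘(ℝ, E) x,
      ∀ u w, 2 * g.val x (A u) w = B u w := by
  have : FiniteDimensional ℝ (TangentSpace 𝓘(ℝ, E) x) := inferInstanceAs (FiniteDimensional ℝ E)
  have : T2Space (TangentSpace 𝓘(ℝ, E) x) := inferInstanceAs (T2Space E)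
  let φ : TangentSpace 𝓘(ℝ, E) x →ₗ[ℝ] Module.Dual ℝ (TangentSpace 𝓘(ℝ, E) x) :=
    ContinuousLinearMap.coeLM ℝ ∘ₗ (g.val x).toLinearMap
  have hφ : Function.Injective φ := by
    rw [injective_iff_map_eq_zero]
    intro v hv
    exact g.nondegenerate x v fun w ↦ LinearMap.congr_fun hv w
  let e := φ.linearEquivOfInjective hφ Subspace.dual_finrank_eq.symm
  let A : TangentSpace 𝓘(ℝ, E) x →ₗ[ℝ] TangentSpace 𝓘(ℝ, E) x :=
    (2⁻¹ : ℝ) • (e.symm.toLinearMap ∘ₗ ContinuousLinearMap.coeLM ℝ ∘ₗ B.toLinearMap)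
  refine ⟨LinearMap.toContinuousLinearMap A, fun u w ↦ ?_⟩
  have h : ∀ β, g.val x (e.symm β) w = β w := fun β ↦
    LinearMap.congr_fun (e.apply_symm_apply β) w
  simp [A, h]

variable (g) in
theorem exists_koszul (Y : Π x : M, TangentSpace 𝓘(ℝ, E) x) (x : M) :
    ∃ A : TangentSpace 𝓘(ℝ, E) x →L[ℝ] TangentSpace 𝓘(ℝ, E) x, MDiffAt (T% Y) x →
      ∀ X Z : Π x : M, TangentSpace 𝓘(ℝ, E) x, MDiffAt (T% X) x → MDiffAt (T% Z) x →
        2 * g.val x (A (X x)) (Z x) = g.koszul X Y Z x := by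
  by_cases hY : MDiffAt (T% Y) x
  · obtain ⟨A, hA⟩ := exists_represent g x (TensorialAt.mkHom₂ (fun X Z ↦ g.koszul X Y Z x) x
      (fun Z hZ ↦ koszul_tensorial_left hY hZ) (fun X hX ↦ koszul_tensorial_right hX hY))
    refine ⟨A, fun _ X Z hX hZ ↦ ?_⟩
    rw [hA]
    exact TensorialAt.mkHom₂_apply _ _ hX hZ
  · exact ⟨0, fun h ↦ absurd h hY⟩

theorem ext_val {v w : TangentSpace 𝓘(ℝ, E) x}
    (h : ∀ Z : Π x : M, TangentSpace 𝓘(ℝ, E) x, MDiffAt (T% Z) x →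
      2 * g.val x v (Z x) = 2 * g.val x w (Z x)) : v = w := by
  refine sub_eq_zero.1 (g.nondegenerate x _ fun u ↦ ?_)
  have := h (FiberBundle.extend E u) (FiberBundle.mdifferentiableAt_extend ..)
  simp only [FiberBundle.extend_apply_self] at this
  simp
  linarith

variable (g) in
/-- Every pseudo-Riemannian metric has a Levi-Civita connection. -/
theorem exists_isLeviCivita :
    ∃ D : CovariantDerivative 𝓘(ℝ, E) E (TangentSpace 𝓘(ℝ, E) : M → Type _),
      IsLeviCivita g D := by
  choose A hA using exists_koszul g
  refine ⟨⟨A, ?_, ?_⟩, ?_, ?_⟩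
  · intro Y Y' x hY hY' _
    ext u
    obtain ⟨X, hX, rfl⟩ : ∃ X : Π x : M, TangentSpace 𝓘(ℝ, E) x, MDiffAt (T% X) x ∧ X x = u :=
      ⟨FiberBundle.extend E u, FiberBundle.mdifferentiableAt_extend .., by simp⟩
    refine ext_val (g := g) fun Z hZ ↦ ?_
    rw [hA _ x (mdifferentiableAt_add_section hY hY') X Z hX hZ, koszul_add_middle hX hY hY' hZ,
      ← hA _ x hY X Z hX hZ, ← hA _ x hY' X Z hX hZ]
    simp
    ring
  · intro Y f x hY hf _
    ext u
    obtain ⟨X, hX, rfl⟩ : ∃ X : Π x : M, TangentSpace 𝓘(ℝ, E) x, MDiffAt (T% X) x ∧ X x = u :=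
      ⟨FiberBundle.extend E u, FiberBundle.mdifferentiableAt_extend .., by simp⟩
    refine ext_val (g := g) fun Z hZ ↦ ?_
    rw [hA _ x (hf.smul_section hY) X Z hX hZ, koszul_smul_middle hf hX hY hZ,
      ← hA _ x hY X Z hX hZ]
    simp [dirDeriv]
    ring
  · intro X Y x hX hY
    refine ext_val (g := g) fun Z hZ ↦ ?_
    have h1 := hA _ x hY X Z hX hZ
    have h2 := hA _ x hX Y Z hY hZ
    have h3 := koszul_sub_swap (g := g) (X := X) (Y := Y) (Z := Z) (x := x)
    simp only [map_sub, sub_apply]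
    linarith
  · intro X Y Z x hX hY hZ
    have h1 := hA _ x hY X Z hX hZ
    have h2 := hA _ x hZ X Y hX hY
    have h3 := koszul_add_swap (g := g) (X := X) (Y := Y) (Z := Z) (x := x)
    rw [g.symm x (Y x)]
    simp only
    linarith

end Existence

variable [FiniteDimensional ℝ E]

/-- The Levi-Civita connection of `g`. It is unique on differentiable vector fields (on the other
fields a `CovariantDerivative` has arbitrary values, which play no role). -/
def PseudoMetric.leviCivita (g : PseudoMetric E M) :
    CovariantDerivative 𝓘(ℝ, E) E (TangentSpace 𝓘(ℝ, E) : M → Type _) :=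
  (exists_isLeviCivita g).choose

theorem PseudoMetric.isLeviCivita_leviCivita (g : PseudoMetric E M) :
    IsLeviCivita g g.leviCivita :=
  (exists_isLeviCivita g).choose_spec

/-- The vector field `∇_X Y`. -/
def PseudoMetric.nabla (g : PseudoMetric E M) (X Y : Π x : M, TangentSpace 𝓘(ℝ, E) x) :
    Π x : M, TangentSpace 𝓘(ℝ, E) x :=
  fun x ↦ g.leviCivita Y x (X x)

/-- The curvature `R(X, Y) Z = ∇_X ∇_Y Z - ∇_Y ∇_X Z - ∇_[X, Y] Z`. -/
def PseudoMetric.curvature (g : PseudoMetric E M) (X Y Z : Π x : M, TangentSpace 𝓘(ℝ, E) x) :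
    Π x : M, TangentSpace 𝓘(ℝ, E) x :=
  g.nabla X (g.nabla Y Z) - g.nabla Y (g.nabla X Z) - g.nabla (mlieBracket 𝓘(ℝ, E) X Y) Z

/-- The exterior derivative of a one-form,
`dη(X, Y) = (1 / 2) (X η(Y) - Y η(X) - η([X, Y]))`. -/
def oneFormDeriv (η : ∀ x : M, TangentSpace 𝓘(ℝ, E) x →L[ℝ] ℝ)
    (X Y : Π x : M, TangentSpace 𝓘(ℝ, E) x) (x : M) : ℝ :=
  (1 / 2) * (dirDeriv X (fun y ↦ η y (Y y)) x - dirDeriv Y (fun y ↦ η y (X y)) x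
    - η x (mlieBracket 𝓘(ℝ, E) X Y x))

variable (E M) in
/-- A contact pseudo-metric structure `(φ, ξ, η, g)` on `M`, with `ε = g(ξ, ξ) = ±1`. -/
structure ContactPseudoMetric where
  /-- The causal character of the characteristic vector field. -/
  ε : ℝ
  ε_eq : ε = 1 ∨ ε = -1
  /-- The `(1, 1)`-tensor field `φ`. -/
  φ : ∀ x : M, TangentSpace 𝓘(ℝ, E) x →L[ℝ] TangentSpace 𝓘(ℝ, E) x
  /-- The characteristic vector field `ξ`. -/
  ξ : ∀ x : M, TangentSpace 𝓘(ℝ, E) x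
  /-- The contact form `η`. -/
  η : ∀ x : M, TangentSpace 𝓘(ℝ, E) x →L[ℝ] ℝ
  /-- The compatible pseudo-Riemannian metric `g`. -/
  g : PseudoMetric E M
  smooth_φ : ContMDiff 𝓘(ℝ, E) (𝓘(ℝ, E).prod 𝓘(ℝ, E →L[ℝ] E)) ∞
    (fun x : M ↦ TotalSpace.mk' (E →L[ℝ] E)
      (E := fun x : M ↦ (TangentSpace 𝓘(ℝ, E) x →L[ℝ] TangentSpace 𝓘(ℝ, E) x)) x (φ x))
  smooth_ξ : CMDiff ∞ (T% ξ)
  smooth_η : ContMDiff 𝓘(ℝ, E) (𝓘(ℝ, E).prod 𝓘(ℝ, E →L[ℝ] ℝ)) ∞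
    (fun x : M ↦ TotalSpace.mk' (E →L[ℝ] ℝ)
      (E := fun x : M ↦ (TangentSpace 𝓘(ℝ, E) x →L[ℝ] ℝ)) x (η x))
  η_ξ : ∀ x, η x (ξ x) = 1
  φ_sq : ∀ x v, φ x (φ x v) = -v + η x v • ξ x
  compatible : ∀ x v w, g.val x (φ x v) (φ x w) = g.val x v w - ε * η x v * η x w
  contact : ∀ (X Y : Π x : M, TangentSpace 𝓘(ℝ, E) x) (x : M),
    MDiffAt (T% X) x → MDiffAt (T% Y) x →
      oneFormDeriv η X Y x = g.val x (X x) (φ x (Y x))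

namespace ContactPseudoMetric

variable (S : ContactPseudoMetric E M)

/-- The vector field `φ X`. -/
def φField (X : Π x : M, TangentSpace 𝓘(ℝ, E) x) : Π x : M, TangentSpace 𝓘(ℝ, E) x :=
  fun x ↦ S.φ x (X x)

/-- The Lie derivative `(L_ξ φ) X = [ξ, φ X] - φ [ξ, X]`. -/
def lieDerivφ (X : Π x : M, TangentSpace 𝓘(ℝ, E) x) (x : M) : TangentSpace 𝓘(ℝ, E) x :=
  mlieBracket 𝓘(ℝ, E) S.ξ (S.φField X) x - S.φ x (mlieBracket 𝓘(ℝ, E) S.ξ X x)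

theorem φField_mdiff {X : Π x : M, TangentSpace 𝓘(ℝ, E) x} {x : M} (hX : MDiffAt (T% X) x) :
    MDiffAt (T% (S.φField X)) x :=
  MDifferentiableAt.clm_bundle_apply (F₁ := E) (F₂ := E)
    (S.smooth_φ.mdifferentiableAt (by simp)) hX

theorem lieDerivφ_tensorial (x : M) : TensorialAt 𝓘(ℝ, E) E (fun X ↦ S.lieDerivφ X x) x where
  smul {f X} hf hX := by
    have h : S.φField (f • X) = f • S.φField X := by ext y; simp [φField]
    simp only [lieDerivφ, h]
    rw [mlieBracket_smul_right hf hX, mlieBracket_smul_right hf (S.φField_mdiff hX)]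
    simp [φField, smul_sub]
  add {X X'} hX hX' := by
    have h : S.φField (X + X') = S.φField X + S.φField X' := by ext y; simp [φField]
    simp only [lieDerivφ, h]
    rw [mlieBracket_add_right hX hX',
      mlieBracket_add_right (S.φField_mdiff hX) (S.φField_mdiff hX')]
    simp
    abel

/-- The tensor field `h = (1 / 2) L_ξ φ`. -/
def h (x : M) : TangentSpace 𝓘(ℝ, E) x →L[ℝ] TangentSpace 𝓘(ℝ, E) x :=
  (1 / 2 : ℝ) • TensorialAt.mkHom (fun X ↦ S.lieDerivφ X x) x (S.lieDerivφ_tensorial x)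

theorem h_apply {X : Π x : M, TangentSpace 𝓘(ℝ, E) x} {x : M} (hX : MDiffAt (T% X) x) :
    S.h x (X x) = (1 / 2 : ℝ) • S.lieDerivφ X x := by
  rw [h, smul_apply, TensorialAt.mkHom_apply (S.lieDerivφ_tensorial x) hX]

/-- The value at `x` of the eigen-distribution `D(c)` of `h`. -/
def eigenDist (c : ℝ) (x : M) : Submodule ℝ (TangentSpace 𝓘(ℝ, E) x) :=
  Module.End.eigenspace (S.h x).toLinearMap c

/-- The condition that defines a `(κ, μ)`-contact pseudo-metric manifold: `ξ` belongs to the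
`(κ, μ)`-nullity distribution, that is,
`R(X, Y) ξ = ε κ (η(Y) X - η(X) Y) + ε μ (η(Y) h X - η(X) h Y)`. -/
def IsKappaMu (κ μ : ℝ) : Prop :=
  ∀ (X Y : Π x : M, TangentSpace 𝓘(ℝ, E) x) (x : M),
    CMDiffAt ∞ (T% X) x → CMDiffAt ∞ (T% Y) x →
      S.g.curvature X Y S.ξ x =
        (S.ε * κ) • (S.η x (Y x) • X x - S.η x (X x) • Y x)
          + (S.ε * μ) • (S.η x (Y x) • S.h x (X x) - S.η x (X x) • S.h x (Y x))

end ContactPseudoMetric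

end ContactPM

end

/-! The argument rests on the field `B = ∇ξ + εφ` (`symξ`). The contact condition says that the skew
part of `∇ξ` is `-εφ`, so `B` is symmetric. Differentiating `φ² = -1 + η ⊗ ξ` along `ξ`, together
with the cyclic identity for `∇φ`, gives `∇_ξ φ = 0`; then `B` anticommutes with `φ`, and `h = φB`.

The nullity condition for `R(ξ, ·)ξ` determines `∇_ξ B`; comparing the parts that commute and
anticommute with `φ` gives `B² = (εκ - 1)φ²` (`IsKappaMu.symξ_symξ`). As `εκ < 1`, the horizontal
space splits into the `±λ`-eigenspaces of `B`, interchanged by `φ`. For horizontal arguments `R(u,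
v)ξ = 0` ties `∇B` to `∇φ`, and symmetry arguments on this splitting show that both have zero
horizontal part. Hence `∇φ` and `∇B` are explicit expressions in `∇ξ` (`IsKappaMu.nablaφ_eq`,
`IsKappaMu.nablaSymξ_eq`).

The Ricci identity turns these formulas into the commutators of `R(x, y)` with `φ` and with `B`,
hence with `h = φB`. On eigenvectors of `h` with eigenvalues `c` and `d`, the last commutator is `(c
- d) g(R(x, y)z, w)` (`IsKappaMu.val_riemann_eigenDist`), which determines every component with `c ≠
d`. The first Bianchi identity then gives the components with `x, y` in one eigenspace and `z, w` in
the other, and the commutator with `φ` those with all four vectors in the same eigenspace.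
Non-degeneracy of `g` assembles the components into the six formulas. -/

noncomputable section

namespace ContactPM

set_option linter.unusedSectionVars false

/-! ### Smoothness of directional derivatives, brackets and covariant derivatives. -/

section Calculus

variable {E : Type*} [NormedAddCommGroup E] [NormedSpace ℝ E]
  {M : Type*} [TopologicalSpace M] [ChartedSpace E M] [IsManifold 𝓘(ℝ, E) ∞ M]
  {X Y Z W : Π x : M, TangentSpace 𝓘(ℝ, E) x} {p : M} {f : M → ℝ}

theorem natCast_le_infty (n : ℕ) : ((n : ℕ∞) : WithTop ℕ∞) ≤ ∞ :=
  WithTop.coe_le_coe.2 le_top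

theorem eventually_mdifferentiableAt (hX : CMDiffAt ∞ (T% X) p) :
    ∀ᶠ q in 𝓝 p, MDiffAt (T% X) q := by
  filter_upwards [(contMDiffAt_iff_contMDiffAt_nhds (n := 1) (by simp)).1
    (hX.of_le (by simp))] with q hq
  exact hq.mdifferentiableAt (by simp)

theorem eventually_mdifferentiableAt_fun (hf : CMDiffAt ∞ f p) :
    ∀ᶠ q in 𝓝 p, MDiffAt f q := by
  filter_upwards [(contMDiffAt_iff_contMDiffAt_nhds (n := 1) (by simp)).1
    (hf.of_le (by simp))] with q hq
  exact hq.mdifferentiableAt (by simp)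

theorem PseudoMetric.pair_smooth (g : PseudoMetric E M)
    (hX : CMDiffAt ∞ (T% X) p) (hY : CMDiffAt ∞ (T% Y) p) : CMDiffAt ∞ (g.pair X Y) p := by
  have : ContMDiffAt 𝓘(ℝ, E) (𝓘(ℝ, E).prod 𝓘(ℝ, ℝ)) ∞
      (fun y : M ↦ TotalSpace.mk' ℝ (E := Bundle.Trivial M ℝ) y (g.val y (X y) (Y y))) p := by
    apply ContMDiffAt.clm_bundle_apply₂ (F₁ := E) (F₂ := E)
    · exact g.smooth.contMDiffAt
    · exact hX
    · exact hY
  simp only [contMDiffAt_totalSpace] at this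
  exact this.2

theorem smooth_extend (v : TangentSpace 𝓘(ℝ, E) p) :
    CMDiffAt ∞ (T% (FiberBundle.extend E v)) p :=
  FiberBundle.contMDiffAt_extend ..

theorem dirDeriv_congr {f' : M → ℝ} (h : f =ᶠ[𝓝 p] f') : dirDeriv X f p = dirDeriv X f' p := by
  exact congrArg (fun L : E →L[ℝ] ℝ ↦ L (X p)) (h.mfderiv_eq (I := 𝓘(ℝ, E)) (I' := 𝓘(ℝ, ℝ)))

variable [FiniteDimensional ℝ E]

theorem mlieBracket_smooth (hX : CMDiffAt ∞ (T% X) p) (hY : CMDiffAt ∞ (T% Y) p) :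
    CMDiffAt ∞ (T% (mlieBracket 𝓘(ℝ, E) X Y)) p := by
  have : IsManifold 𝓘(ℝ, E) ((⊤ : ℕ∞) + 1) M := by simpa using ‹IsManifold 𝓘(ℝ, E) ∞ M›
  have : IsManifold 𝓘(ℝ, E) (minSmoothness ℝ 2) M :=
    IsManifold.of_le (n := ∞) (by simpa using natCast_le_infty 2)
  exact ContMDiffAt.mlieBracket_vectorField (m := ⊤) (n := ⊤) hX hY (by simp)

theorem mlieBracket_smul_right' (hf : MDiffAt f p) (hY : MDiffAt (T% Y) p) :
    mlieBracket 𝓘(ℝ, E) X (f • Y) p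
      = dirDeriv X f p • Y p + f p • mlieBracket 𝓘(ℝ, E) X Y p :=
  mlieBracket_smul_right hf hY

theorem exists_pair_ne_zero_or (g : PseudoMetric E M) (p : M) :
    (∃ v w : TangentSpace 𝓘(ℝ, E) p, g.val p v w ≠ 0) ∨ Subsingleton E := by
  by_cases h : ∃ v w : TangentSpace 𝓘(ℝ, E) p, g.val p v w ≠ 0
  · exact .inl h
  · push Not at h
    refine .inr ⟨fun a b ↦ ?_⟩
    have h1 : ∀ v : TangentSpace 𝓘(ℝ, E) p, v = 0 := fun v ↦ g.nondegenerate p v (h v)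
    exact (h1 a).trans (h1 b).symm

/-- The derivative is read off from the bracket: `[X, fZ] - f[X, Z] = (Xf) Z`, paired with a field
`W` such that `g(Z, W) ≠ 0` near `p`. Such fields exist unless the model space is trivial. -/
theorem PseudoMetric.dirDeriv_smooth (g : PseudoMetric E M)
    (hX : CMDiffAt ∞ (T% X) p) (hf : CMDiffAt ∞ f p) : CMDiffAt ∞ (dirDeriv X f) p := by
  rcases exists_pair_ne_zero_or g p with ⟨v, w, hvw⟩ | hE
  · set Z : Π x : M, TangentSpace 𝓘(ℝ, E) x := FiberBundle.extend E v with hZdef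
    set W : Π x : M, TangentSpace 𝓘(ℝ, E) x := FiberBundle.extend E w with hWdef
    have hZ : CMDiffAt ∞ (T% Z) p := smooth_extend v
    have hW : CMDiffAt ∞ (T% W) p := smooth_extend w
    have hZW : CMDiffAt ∞ (g.pair Z W) p := g.pair_smooth hZ hW
    have h0 : g.pair Z W p ≠ 0 := by simpa [PseudoMetric.pair, Z, W] using hvw
    have h1 : CMDiffAt ∞ (fun q ↦ (g.pair (mlieBracket 𝓘(ℝ, E) X (f • Z)) W q
        - f q * g.pair (mlieBracket 𝓘(ℝ, E) X Z) W q) / g.pair Z W q) p :=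
      ((g.pair_smooth (mlieBracket_smooth hX (hf.smul_section hZ)) hW).sub
        (hf.mul (g.pair_smooth (mlieBracket_smooth hX hZ) hW))).div₀ hZW h0
    refine h1.congr_of_eventuallyEq ?_
    filter_upwards [eventually_mdifferentiableAt hZ, eventually_mdifferentiableAt_fun hf,
      hZW.continuousAt.eventually_ne h0] with q hq hfq hne
    rw [eq_div_iff hne]
    simp only [PseudoMetric.pair]
    rw [mlieBracket_smul_right' hfq hq]
    simp
  · have : dirDeriv X f = fun _ ↦ 0 := by
      funext q
      have : X q = 0 := Subsingleton.elim (α := E) _ _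
      simp [dirDeriv, this]
    rw [this]
    exact contMDiffAt_const

/-- Subtracting `f` times the Jacobi identity for `X, Y, Z` from that for `X, Y, fZ` leaves a
multiple of `Z`, whose coefficient is the claimed difference. -/
theorem PseudoMetric.dirDeriv_mlieBracket (g : PseudoMetric E M) (hX : CMDiffAt ∞ (T% X) p)
    (hY : CMDiffAt ∞ (T% Y) p) (hf : CMDiffAt ∞ f p) :
    dirDeriv (mlieBracket 𝓘(ℝ, E) X Y) f p
      = dirDeriv X (dirDeriv Y f) p - dirDeriv Y (dirDeriv X f) p := by
  rcases exists_pair_ne_zero_or g p with ⟨v, w, hvw⟩ | hE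
  · have : IsManifold 𝓘(ℝ, E) (minSmoothness ℝ 3) M :=
      IsManifold.of_le (n := ∞) (by simpa using natCast_le_infty 3)
    have hv : v ≠ 0 := by rintro rfl; simp at hvw
    set Z : Π x : M, TangentSpace 𝓘(ℝ, E) x := FiberBundle.extend E v with hZdef
    have hZ : CMDiffAt ∞ (T% Z) p := smooth_extend v
    have hZp : Z p = v := by simp [Z]
    have hfm := hf.mdifferentiableAt (n := ∞) (by simp)
    have key : ∀ {X Y : Π x : M, TangentSpace 𝓘(ℝ, E) x}, CMDiffAt ∞ (T% X) p →
        CMDiffAt ∞ (T% Y) p → mlieBracket 𝓘(ℝ, E) X (mlieBracket 𝓘(ℝ, E) Y (f • Z)) p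
          = dirDeriv X (dirDeriv Y f) p • Z p
            + dirDeriv Y f p • mlieBracket 𝓘(ℝ, E) X Z p
            + (dirDeriv X f p • mlieBracket 𝓘(ℝ, E) Y Z p
            + f p • mlieBracket 𝓘(ℝ, E) X (mlieBracket 𝓘(ℝ, E) Y Z) p) := by
      intro X Y hX hY
      have hd := (g.dirDeriv_smooth hY hf).mdifferentiableAt (n := ∞) (by simp)
      have hb := (mlieBracket_smooth hY hZ).mdifferentiableAt (n := ∞) (by simp)
      have hZm := hZ.mdifferentiableAt (n := ∞) (by simp)
      have e : mlieBracket 𝓘(ℝ, E) Y (f • Z) =ᶠ[𝓝 p]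
          dirDeriv Y f • Z + f • mlieBracket 𝓘(ℝ, E) Y Z := by
        filter_upwards [eventually_mdifferentiableAt hZ, eventually_mdifferentiableAt_fun hf]
          with q hq hfq
        exact mlieBracket_smul_right' hfq hq
      rw [Filter.EventuallyEq.mlieBracket_vectorField_eq (Filter.EventuallyEq.refl _ X) e,
        mlieBracket_add_right (hd.smul_section hZm) (hfm.smul_section hb),
        mlieBracket_smul_right' hd hZm, mlieBracket_smul_right' hfm hb]
    have c2 : ∀ {X : Π x : M, TangentSpace 𝓘(ℝ, E) x}, CMDiffAt ∞ (T% X) p →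
        CMDiffAt (minSmoothness ℝ 2) (T% X) p := fun h ↦ h.of_le (by simpa using natCast_le_infty 2)
    have J := leibniz_identity_mlieBracket_apply (c2 hX) (c2 hY) (c2 (hf.smul_section hZ))
    have J' := leibniz_identity_mlieBracket_apply (c2 hX) (c2 hY) (c2 hZ)
    rw [key hX hY, key hY hX, mlieBracket_smul_right' hfm (hZ.mdifferentiableAt (by simp)), J']
      at J
    have : (dirDeriv (mlieBracket 𝓘(ℝ, E) X Y) f p
      - (dirDeriv X (dirDeriv Y f) p - dirDeriv Y (dirDeriv X f) p)) • Z p = 0 := by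
      rw [smul_add] at J
      linear_combination (norm := module) -J
    rw [hZp] at this
    exact sub_eq_zero.1 ((smul_eq_zero.1 this).resolve_right hv)
  · have : ∀ (X : Π x : M, TangentSpace 𝓘(ℝ, E) x) (f : M → ℝ), dirDeriv X f p = 0 := by
      intro X f
      have : X p = 0 := Subsingleton.elim (α := E) _ _
      simp [dirDeriv, this]
    simp [this]

/-- In a local frame the coefficients of `X` solve a linear system with the Gram matrix `L` of `g`.
It is invertible at `p` by non-degeneracy, hence nearby, and inversion is smooth. -/
theorem PseudoMetric.smooth_of_pair (g : PseudoMetric E M)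
    (h : ∀ Z : Π x : M, TangentSpace 𝓘(ℝ, E) x, CMDiffAt ∞ (T% Z) p → CMDiffAt ∞ (g.pair X Z) p) :
    CMDiffAt ∞ (T% X) p := by
  let t := trivializationAt E (TangentSpace 𝓘(ℝ, E) : M → Type _) p
  have hp : p ∈ t.baseSet := FiberBundle.mem_baseSet_trivializationAt E _ p
  let b := Module.finBasis ℝ E
  let s := t.localFrame b
  have hs : ∀ i, CMDiffAt ∞ (T% (s i)) p := fun i ↦ contMDiffAt_localFrame_of_mem ∞ _ b i hp
  rw [contMDiffAt_iff_localFrameCoeff (e := t) b hp]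
  let c : ∀ q, Fin (finrank ℝ E) → ℝ :=
    fun q i ↦ t.localFrameCoeff 𝓘(ℝ, E) b i q (X q)
  let e : Fin (finrank ℝ E) → Fin (finrank ℝ E) →
      ((Fin (finrank ℝ E) → ℝ) →L[ℝ] (Fin (finrank ℝ E) → ℝ)) :=
    fun i j ↦ (ContinuousLinearMap.proj (R := ℝ) j).smulRight (Pi.single i 1)
  let L : M → ((Fin (finrank ℝ E) → ℝ) →L[ℝ] (Fin (finrank ℝ E) → ℝ)) :=
    fun q ↦ ∑ i, ∑ j, g.pair (s j) (s i) q • e i j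
  have hL : ∀ q v i, L q v i = ∑ j, g.pair (s j) (s i) q * v j := by
    intro q v i
    simp [L, e, Finset.sum_apply, Pi.single_apply]
  have hLs : CMDiffAt ∞ L p := by
    refine contMDiffAt_finsetSum fun i _ ↦ contMDiffAt_finsetSum fun j _ ↦ ?_
    exact (g.pair_smooth (hs j) (hs i)).smul contMDiffAt_const
  have hu : IsUnit (L p) := by
    rw [ContinuousLinearMap.isUnit_iff_bijective]
    have hinj : Function.Injective (L p) := by
      rw [injective_iff_map_eq_zero]
      intro v hv
      have h1 : ∑ j, v j • s j p = 0 := by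
        refine g.nondegenerate p _ fun w ↦ ?_
        rw [← (t.basisAt b hp).sum_repr w, map_sum]
        refine Finset.sum_eq_zero fun i _ ↦ ?_
        have h2 := congrFun hv i
        rw [hL] at h2
        have h3 : s i p = t.basisAt b hp i := t.localFrame_apply_of_mem_baseSet b hp
        rw [← h3, map_smul, map_sum, sum_apply]
        simp only [PseudoMetric.pair, Pi.zero_apply] at h2
        simp only [map_smul, smul_apply, smul_eq_mul]
        simp only [mul_comm (v _), h2, mul_zero]
      have h3 : ∀ j, s j p = t.basisAt b hp j := fun j ↦ t.localFrame_apply_of_mem_baseSet b hp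
      simp only [h3] at h1
      funext j
      exact Fintype.linearIndependent_iff.1 (t.basisAt b hp).linearIndependent v h1 j
    exact ⟨hinj, (LinearMap.injective_iff_surjective (f := (L p).toLinearMap)).1 hinj⟩
  obtain ⟨u, hu⟩ := hu
  have hinv : CMDiffAt ∞ (fun q ↦ Ring.inverse (L q)) p := by
    have := contDiffAt_ringInverse ℝ (n := ∞) u
    rw [hu] at this
    exact this.contMDiffAt.comp p hLs
  have hy : ContMDiffAt 𝓘(ℝ, E) 𝓘(ℝ, Fin (finrank ℝ E) → ℝ) ∞ (fun q i ↦ g.pair X (s i) q) p :=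
    contMDiffAt_pi_space.2 fun i ↦ h _ (hs i)
  have hc : ContMDiffAt 𝓘(ℝ, E) 𝓘(ℝ, Fin (finrank ℝ E) → ℝ) ∞ c p := by
    refine (hinv.clm_apply hy).congr_of_eventuallyEq ?_
    have hunit : ∀ᶠ q in 𝓝 p, IsUnit (L q) := by
      refine hLs.continuousAt.eventually ?_
      rw [← hu]
      exact Units.nhds u
    filter_upwards [t.eventually_eq_localFrame_sum_coeff_smul (I := 𝓘(ℝ, E)) (s := X) b hp, hunit]
      with q hq huq
    have h4 : (fun i ↦ g.pair X (s i) q) = L q (c q) := by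
      funext i
      rw [hL]
      simp only [PseudoMetric.pair]
      rw [hq, map_sum, sum_apply]
      simp [c, s, mul_comm]
    rw [h4, ← mul_apply_eq_comp, Ring.inverse_mul_cancel _ huq]
    rfl
  exact fun i ↦ contMDiffAt_pi_space.1 hc i

/-! ### The Koszul formula and the rules for `∇`. -/

section LeviCivita

variable (g : PseudoMetric E M)

theorem PseudoMetric.two_mul_val_nabla (hX : MDiffAt (T% X) p) (hY : MDiffAt (T% Y) p)
    (hZ : MDiffAt (T% Z) p) : 2 * g.val p (g.nabla X Y p) (Z p) = g.koszul X Y Z p := by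
  have h := g.isLeviCivita_leviCivita
  have m1 := h.metric X Y Z p hX hY hZ
  have m2 := h.metric Y X Z p hY hX hZ
  have m3 := h.metric Z X Y p hZ hX hY
  rw [PseudoMetric.koszul, ← h.torsion_free X Y p hX hY, ← h.torsion_free X Z p hX hZ,
    ← h.torsion_free Y Z p hY hZ, m1, m2, m3]
  simp only [map_sub, sub_apply, PseudoMetric.nabla, g.symm p (X p), g.symm p (Y p)]
  ring

theorem PseudoMetric.koszul_smooth (hX : CMDiffAt ∞ (T% X) p) (hY : CMDiffAt ∞ (T% Y) p)
    (hZ : CMDiffAt ∞ (T% Z) p) : CMDiffAt ∞ (g.koszul X Y Z) p := by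
  have h1 : ∀ {X Y Z : Π x : M, TangentSpace 𝓘(ℝ, E) x}, CMDiffAt ∞ (T% X) p →
      CMDiffAt ∞ (T% Y) p → CMDiffAt ∞ (T% Z) p → CMDiffAt ∞ (dirDeriv X (g.pair Y Z)) p :=
    fun hX hY hZ ↦ g.dirDeriv_smooth hX (g.pair_smooth hY hZ)
  have h2 : ∀ {X Y Z : Π x : M, TangentSpace 𝓘(ℝ, E) x}, CMDiffAt ∞ (T% X) p →
      CMDiffAt ∞ (T% Y) p → CMDiffAt ∞ (T% Z) p →
      CMDiffAt ∞ (g.pair (mlieBracket 𝓘(ℝ, E) X Y) Z) p :=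
    fun hX hY hZ ↦ g.pair_smooth (mlieBracket_smooth hX hY) hZ
  exact (((((h1 hX hY hZ).add (h1 hY hX hZ)).sub (h1 hZ hX hY)).add (h2 hX hY hZ)).sub
    (h2 hX hZ hY)).sub (h2 hY hZ hX)

theorem PseudoMetric.nabla_smooth (hX : CMDiffAt ∞ (T% X) p) (hY : CMDiffAt ∞ (T% Y) p) :
    CMDiffAt ∞ (T% (g.nabla X Y)) p := by
  refine g.smooth_of_pair fun Z hZ ↦ ?_
  refine ((contMDiffAt_const (c := (2⁻¹ : ℝ))).mul (g.koszul_smooth hX hY hZ)).congr_of_eventuallyEq ?_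
  filter_upwards [eventually_mdifferentiableAt hX, eventually_mdifferentiableAt hY,
    eventually_mdifferentiableAt hZ] with q h1 h2 h3
  simp only [Pi.mul_apply, ← g.two_mul_val_nabla h1 h2 h3, PseudoMetric.pair]
  ring

/-- Tensoriality is tested on fields that are only differentiable at `p`, where smoothness of `∇_X
Y` is not available. Expanding `X` in a smooth frame suffices, since `∇_X Y` is pointwise linear in
`X`. -/
theorem PseudoMetric.nabla_mdifferentiableAt (hX : MDiffAt (T% X) p)
    (hY : CMDiffAt ∞ (T% Y) p) : MDiffAt (T% (g.nabla X Y)) p := by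
  let t := trivializationAt E (TangentSpace 𝓘(ℝ, E) : M → Type _) p
  have hp : p ∈ t.baseSet := FiberBundle.mem_baseSet_trivializationAt E _ p
  let b := Module.finBasis ℝ E
  let s := t.localFrame b
  have hs : ∀ i, CMDiffAt ∞ (T% (s i)) p := fun i ↦ contMDiffAt_localFrame_of_mem ∞ _ b i hp
  have h1 : MDiffAt (T% (fun q ↦ ∑ i, (LinearMap.piApply (t.localFrameCoeff 𝓘(ℝ, E) b i) X) q •
      g.nabla (s i) Y q)) p :=
    .sum_section fun i _ ↦ (mdifferentiableAt_localFrameCoeff b hp hX i).smul_section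
      ((g.nabla_smooth (hs i) hY).mdifferentiableAt (by simp))
  refine h1.congr_of_eventuallyEq ?_
  filter_upwards [t.eventually_eq_localFrame_sum_coeff_smul (I := 𝓘(ℝ, E)) (s := X) b hp]
    with q hq
  congr 1
  simp only [PseudoMetric.nabla]
  conv_lhs => rw [hq]
  simp [s]

variable {g}

theorem PseudoMetric.nabla_congr {Y' : Π x : M, TangentSpace 𝓘(ℝ, E) x}
    (hY : MDiffAt (T% Y) p) (h : Y =ᶠ[𝓝 p] Y') : g.nabla X Y p = g.nabla X Y' p := by
  have := g.leviCivita.isCovariantDerivativeOn.congr_of_eventuallyEq hY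
    (hY.congr_of_eventuallyEq (by filter_upwards [h] with q hq; rw [hq])) Filter.univ_mem h
  exact congrArg (fun L : E →L[ℝ] E ↦ L (X p)) this

theorem PseudoMetric.nabla_add (hY : MDiffAt (T% Y) p) (hZ : MDiffAt (T% Z) p) :
    g.nabla X (Y + Z) p = g.nabla X Y p + g.nabla X Z p := by
  simp [PseudoMetric.nabla, g.leviCivita.isCovariantDerivativeOn.add hY hZ]

theorem PseudoMetric.nabla_smul (hf : MDiffAt f p) (hY : MDiffAt (T% Y) p) :
    g.nabla X (f • Y) p = f p • g.nabla X Y p + dirDeriv X f p • Y p := by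
  simp [PseudoMetric.nabla, g.leviCivita.isCovariantDerivativeOn.leibniz hY hf, dirDeriv]

theorem PseudoMetric.nabla_const_smul (a : ℝ) (hY : MDiffAt (T% Y) p) :
    g.nabla X (a • Y) p = a • g.nabla X Y p := by
  have := PseudoMetric.nabla_smul (g := g) (X := X) (f := fun _ ↦ a) mdifferentiableAt_const hY
  rw [show (fun _ ↦ a : M → ℝ) • Y = a • Y from rfl] at this
  simpa [dirDeriv, mvfderiv_const] using this

theorem PseudoMetric.nabla_neg (hY : MDiffAt (T% Y) p) :
    g.nabla X (-Y) p = -g.nabla X Y p := by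
  simpa using PseudoMetric.nabla_const_smul (g := g) (X := X) (-1) hY

theorem PseudoMetric.nabla_sub (hY : MDiffAt (T% Y) p) (hZ : MDiffAt (T% Z) p) :
    g.nabla X (Y - Z) p = g.nabla X Y p - g.nabla X Z p := by
  rw [sub_eq_add_neg, PseudoMetric.nabla_add hY (mdifferentiableAt_neg_section hZ),
    PseudoMetric.nabla_neg hZ, sub_eq_add_neg]

theorem PseudoMetric.torsion_free (hX : MDiffAt (T% X) p) (hY : MDiffAt (T% Y) p) :
    mlieBracket 𝓘(ℝ, E) X Y p = g.nabla X Y p - g.nabla Y X p :=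
  (g.isLeviCivita_leviCivita.torsion_free X Y p hX hY).symm

theorem PseudoMetric.dirDeriv_pair (hX : MDiffAt (T% X) p) (hY : MDiffAt (T% Y) p)
    (hZ : MDiffAt (T% Z) p) : dirDeriv X (g.pair Y Z) p
      = g.val p (g.nabla X Y p) (Z p) + g.val p (Y p) (g.nabla X Z p) :=
  g.isLeviCivita_leviCivita.metric X Y Z p hX hY hZ

end LeviCivita

end Calculus

/-! ### Symmetries and tensoriality of the curvature. -/

section Curvature

variable {E : Type*} [NormedAddCommGroup E] [NormedSpace ℝ E] [FiniteDimensional ℝ E]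
  {M : Type*} [TopologicalSpace M] [ChartedSpace E M] [IsManifold 𝓘(ℝ, E) ∞ M]
  {X Y Z W : Π x : M, TangentSpace 𝓘(ℝ, E) x} {p : M} {f : M → ℝ} (g : PseudoMetric E M)

namespace PseudoMetric

theorem curvature_apply : g.curvature X Y Z p = g.nabla X (g.nabla Y Z) p
    - g.nabla Y (g.nabla X Z) p - g.nabla (mlieBracket 𝓘(ℝ, E) X Y) Z p := rfl

theorem curvature_skew : g.curvature X Y Z p = -g.curvature Y X Z p := by
  simp only [curvature_apply]
  rw [mlieBracket_swap (V := X)]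
  simp only [nabla, Pi.neg_apply, map_neg]
  abel

/-- This is the Jacobi identity with both brackets expanded by vanishing torsion. -/
theorem curvature_bianchi (hX : CMDiffAt ∞ (T% X) p) (hY : CMDiffAt ∞ (T% Y) p)
    (hZ : CMDiffAt ∞ (T% Z) p) :
    g.curvature X Y Z p + g.curvature Y Z X p + g.curvature Z X Y p = 0 := by
  have : IsManifold 𝓘(ℝ, E) (minSmoothness ℝ 3) M :=
    IsManifold.of_le (n := ∞) (by simpa using natCast_le_infty 3)
  have key : ∀ {X Y Z : Π x : M, TangentSpace 𝓘(ℝ, E) x}, CMDiffAt ∞ (T% X) p →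
      CMDiffAt ∞ (T% Y) p → CMDiffAt ∞ (T% Z) p →
      mlieBracket 𝓘(ℝ, E) X (mlieBracket 𝓘(ℝ, E) Y Z) p = g.nabla X (g.nabla Y Z) p
        - g.nabla X (g.nabla Z Y) p - g.nabla (mlieBracket 𝓘(ℝ, E) Y Z) X p := by
    intro X Y Z hX hY hZ
    have d1 := (g.nabla_smooth hY hZ).mdifferentiableAt (n := ∞) (by simp)
    have d2 := (g.nabla_smooth hZ hY).mdifferentiableAt (n := ∞) (by simp)
    have e : mlieBracket 𝓘(ℝ, E) Y Z =ᶠ[𝓝 p] g.nabla Y Z - g.nabla Z Y := by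
      filter_upwards [eventually_mdifferentiableAt hY, eventually_mdifferentiableAt hZ]
        with q h1 h2
      exact torsion_free h1 h2
    have hb := (mlieBracket_smooth hY hZ).mdifferentiableAt (n := ∞) (by simp)
    rw [torsion_free (g := g) (hX.mdifferentiableAt (by simp)) hb, nabla_congr hb e,
      nabla_sub d1 d2]
  have c2 : ∀ {X : Π x : M, TangentSpace 𝓘(ℝ, E) x}, CMDiffAt ∞ (T% X) p →
      CMDiffAt (minSmoothness ℝ 2) (T% X) p :=
    fun h ↦ h.of_le (by simpa using natCast_le_infty 2)
  have J := leibniz_identity_mlieBracket_apply (c2 hX) (c2 hY) (c2 hZ)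
  rw [mlieBracket_swap_apply (V := mlieBracket 𝓘(ℝ, E) X Y), mlieBracket_swap (V := X) (W := Z)] at J
  have hb := (mlieBracket_smooth hZ hX).mdifferentiableAt (n := ∞) (by simp)
  have e : mlieBracket 𝓘(ℝ, E) Y (-mlieBracket 𝓘(ℝ, E) Z X) p
      = -mlieBracket 𝓘(ℝ, E) Y (mlieBracket 𝓘(ℝ, E) Z X) p := by
    simpa using mlieBracket_const_smul_right (I := 𝓘(ℝ, E)) (V := Y) (c := (-1 : ℝ)) hb
  rw [e, key hX hY hZ, key hZ hX hY, key hY hZ hX] at J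
  simp only [curvature_apply]
  linear_combination (norm := module) J

/-- Metricity expands `[X, Y] g(Z, W) = X Y g(Z, W) - Y X g(Z, W)`; the products of first
derivatives cancel. -/
theorem val_curvature_skew (hX : CMDiffAt ∞ (T% X) p) (hY : CMDiffAt ∞ (T% Y) p)
    (hZ : CMDiffAt ∞ (T% Z) p) (hW : CMDiffAt ∞ (T% W) p) :
    g.val p (g.curvature X Y Z p) (W p) = -g.val p (g.curvature X Y W p) (Z p) := by
  have md : ∀ {X : Π x : M, TangentSpace 𝓘(ℝ, E) x}, CMDiffAt ∞ (T% X) p →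
      MDiffAt (T% X) p := fun h ↦ h.mdifferentiableAt (by simp)
  have key : ∀ {X Y : Π x : M, TangentSpace 𝓘(ℝ, E) x}, CMDiffAt ∞ (T% X) p →
      CMDiffAt ∞ (T% Y) p → dirDeriv X (dirDeriv Y (g.pair Z W)) p
        = g.val p (g.nabla X (g.nabla Y Z) p) (W p) + g.val p (g.nabla Y Z p) (g.nabla X W p)
          + (g.val p (g.nabla X Z p) (g.nabla Y W p)
            + g.val p (Z p) (g.nabla X (g.nabla Y W) p)) := by
    intro X Y hX hY
    have e : dirDeriv Y (g.pair Z W) =ᶠ[𝓝 p] g.pair (g.nabla Y Z) W + g.pair Z (g.nabla Y W) := by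
      filter_upwards [eventually_mdifferentiableAt hY, eventually_mdifferentiableAt hZ,
        eventually_mdifferentiableAt hW] with q h1 h2 h3
      exact dirDeriv_pair h1 h2 h3
    have n1 := md (g.nabla_smooth hY hZ)
    have n2 := md (g.nabla_smooth hY hW)
    rw [dirDeriv_congr e, ← dirDeriv_pair (md hX) n1 (md hW), ← dirDeriv_pair (md hX) (md hZ) n2]
    simp only [dirDeriv, mvfderiv_add (g.pair_mdiff n1 (md hW)) (g.pair_mdiff (md hZ) n2)]
    simp
  have h := g.dirDeriv_mlieBracket hX hY (g.pair_smooth hZ hW)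
  rw [key hX hY, key hY hX,
    dirDeriv_pair (md (mlieBracket_smooth hX hY)) (md hZ) (md hW)] at h
  simp only [curvature_apply, map_sub, sub_apply, g.symm p _ (Z p)]
  linarith

theorem val_curvature_pair_symm (hX : CMDiffAt ∞ (T% X) p) (hY : CMDiffAt ∞ (T% Y) p)
    (hZ : CMDiffAt ∞ (T% Z) p) (hW : CMDiffAt ∞ (T% W) p) :
    g.val p (g.curvature X Y Z p) (W p) = g.val p (g.curvature Z W X p) (Y p) := by
  have b : ∀ {X Y Z W : Π x : M, TangentSpace 𝓘(ℝ, E) x}, CMDiffAt ∞ (T% X) p →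
      CMDiffAt ∞ (T% Y) p → CMDiffAt ∞ (T% Z) p →
      g.val p (g.curvature X Y Z p) (W p) + g.val p (g.curvature Y Z X p) (W p)
        + g.val p (g.curvature Z X Y p) (W p) = 0 := by
    intro X Y Z W hX hY hZ
    simpa using congrArg (fun v ↦ g.val p v (W p)) (g.curvature_bianchi hX hY hZ)
  have s : ∀ (X Y Z W : Π x : M, TangentSpace 𝓘(ℝ, E) x), g.val p (g.curvature X Y Z p) (W p)
      = -g.val p (g.curvature Y X Z p) (W p) := by
    intro X Y Z W
    rw [curvature_skew]
    simp
  have b1 := b (W := W) hX hY hZ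
  have b2 := b (W := X) hY hZ hW
  have b3 := b (W := Y) hZ hW hX
  have b4 := b (W := Z) hW hX hY
  have e1 := g.val_curvature_skew hX hY hZ hW
  have e2 := g.val_curvature_skew hY hZ hX hW
  have e3 := g.val_curvature_skew hZ hX hY hW
  have e4 := g.val_curvature_skew hZ hW hX hY
  have e5 := g.val_curvature_skew hW hX hY hZ
  have e6 := g.val_curvature_skew hW hY hX hZ
  have s1 := s X Z Y W
  have s2 := s X Z W Y
  have s3 := s Y W Z X
  have s4 := s Y W X Z
  linarith

theorem curvature_tensorial_left (hZ : CMDiffAt ∞ (T% Z) p) :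
    TensorialAt 𝓘(ℝ, E) E (fun X ↦ g.curvature X Y Z p) p where
  smul {f X} hf hX := by
    have e : g.nabla (f • X) Z = f • g.nabla X Z := by
      funext q
      simp [nabla]
    simp only [curvature_apply, e]
    rw [nabla_smul hf (g.nabla_mdifferentiableAt hX hZ)]
    simp only [nabla, Pi.smul_apply', mlieBracket_smul_left hf hX, map_add, map_smul, map_neg,
      neg_smul, dirDeriv]
    module
  add {X X'} hX hX' := by
    have e : g.nabla (X + X') Z = g.nabla X Z + g.nabla X' Z := by
      funext q
      simp [nabla]
    simp only [curvature_apply, e]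
    rw [nabla_add (g.nabla_mdifferentiableAt hX hZ) (g.nabla_mdifferentiableAt hX' hZ)]
    simp only [nabla, Pi.add_apply, mlieBracket_add_left hX hX', map_add]
    module

variable {g} in
-- Tensoriality is direct in the first slot and passes to the second by skewness. Pair symmetry
-- moves the third slot to the first, so no second-order Leibniz computation is needed.
theorem curvature_congr {X' Y' Z' : Π x : M, TangentSpace 𝓘(ℝ, E) x}
    (hX : CMDiffAt ∞ (T% X) p) (hY : CMDiffAt ∞ (T% Y) p) (hZ : CMDiffAt ∞ (T% Z) p)
    (hX' : CMDiffAt ∞ (T% X') p) (hY' : CMDiffAt ∞ (T% Y') p) (hZ' : CMDiffAt ∞ (T% Z') p)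
    (eX : X p = X' p) (eY : Y p = Y' p) (eZ : Z p = Z' p) :
    g.curvature X Y Z p = g.curvature X' Y' Z' p := by
  have c1 : ∀ {X X' Y Z : Π x : M, TangentSpace 𝓘(ℝ, E) x}, CMDiffAt ∞ (T% X) p →
      CMDiffAt ∞ (T% X') p → CMDiffAt ∞ (T% Z) p → X p = X' p →
      g.curvature X Y Z p = g.curvature X' Y Z p :=
    fun hX hX' hZ h ↦ (g.curvature_tensorial_left hZ).pointwise
      (hX.mdifferentiableAt (by simp)) (hX'.mdifferentiableAt (by simp)) h
  rw [c1 hX hX' hZ eX, curvature_skew, c1 hY hY' hZ eY, ← curvature_skew]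
  refine sub_eq_zero.1 (g.nondegenerate p _ fun w ↦ ?_)
  have hw := smooth_extend w
  have h1 := g.val_curvature_pair_symm hX' hY' hZ hw
  have h2 := g.val_curvature_pair_symm hX' hY' hZ' hw
  rw [c1 hZ hZ' hX' eZ, ← h2] at h1
  simpa [sub_eq_zero] using h1

/-- The Riemann curvature tensor at `p`. -/
def riemann (p : M) (u v w : TangentSpace 𝓘(ℝ, E) p) : TangentSpace 𝓘(ℝ, E) p :=
  g.curvature (FiberBundle.extend E u) (FiberBundle.extend E v) (FiberBundle.extend E w) p

theorem curvature_eq_riemann (hX : CMDiffAt ∞ (T% X) p) (hY : CMDiffAt ∞ (T% Y) p)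
    (hZ : CMDiffAt ∞ (T% Z) p) : g.curvature X Y Z p = g.riemann p (X p) (Y p) (Z p) :=
  curvature_congr hX hY hZ (smooth_extend _) (smooth_extend _) (smooth_extend _)
    (by simp) (by simp) (by simp)

variable (u v w z : TangentSpace 𝓘(ℝ, E) p)

theorem riemann_skew : g.riemann p u v w = -g.riemann p v u w := g.curvature_skew

theorem riemann_bianchi : g.riemann p u v w + g.riemann p v w u + g.riemann p w u v = 0 :=
  g.curvature_bianchi (smooth_extend _) (smooth_extend _) (smooth_extend _)

theorem val_riemann_skew : g.val p (g.riemann p u v w) z = -g.val p (g.riemann p u v z) w := by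
  simpa [riemann] using g.val_curvature_skew (smooth_extend u) (smooth_extend v) (smooth_extend w)
    (smooth_extend z)

theorem val_riemann_pair_symm :
    g.val p (g.riemann p u v w) z = g.val p (g.riemann p w z u) v := by
  simpa [riemann] using g.val_curvature_pair_symm (smooth_extend u) (smooth_extend v) (smooth_extend w)
    (smooth_extend z)

theorem riemann_smul_left (a : ℝ) : g.riemann p (a • u) v w = a • g.riemann p u v w :=
  (TensorialAt.mkHom _ p (g.curvature_tensorial_left (smooth_extend w))).map_smul
    a u

theorem riemann_smul_right (a : ℝ) : g.riemann p u v (a • w) = a • g.riemann p u v w := by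
  refine sub_eq_zero.1 (g.nondegenerate p _ fun z ↦ ?_)
  simp only [map_sub, map_smul, sub_apply, smul_apply]
  rw [val_riemann_pair_symm, g.val_riemann_pair_symm u v w, riemann_smul_left]
  simp

end PseudoMetric

end Curvature

/-! ### Covariant derivatives of fields of endomorphisms. -/

section Endomorphisms

variable {E : Type*} [NormedAddCommGroup E] [NormedSpace ℝ E]
  {M : Type*} [TopologicalSpace M] [ChartedSpace E M] [IsManifold 𝓘(ℝ, E) ∞ M]

/-- The field of endomorphisms `T` maps vector fields that are differentiable at `p` to vector
fields that are differentiable at `p`. -/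
def EndMDiffAt (T : ∀ x : M, TangentSpace 𝓘(ℝ, E) x →L[ℝ] TangentSpace 𝓘(ℝ, E) x) (p : M) : Prop :=
  ∀ Y : Π x : M, TangentSpace 𝓘(ℝ, E) x, MDiffAt (T% Y) p → MDiffAt (T% (fun q ↦ T q (Y q))) p

variable {T T' : ∀ x : M, TangentSpace 𝓘(ℝ, E) x →L[ℝ] TangentSpace 𝓘(ℝ, E) x} {p : M}
  {X Y : Π x : M, TangentSpace 𝓘(ℝ, E) x}

theorem EndMDiffAt.add (hT : EndMDiffAt T p) (hT' : EndMDiffAt T' p) :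
    EndMDiffAt (fun q ↦ T q + T' q) p :=
  fun Y hY ↦ mdifferentiableAt_add_section (hT Y hY) (hT' Y hY)

theorem EndMDiffAt.const_smul (a : ℝ) (hT : EndMDiffAt T p) : EndMDiffAt (fun q ↦ a • T q) p :=
  fun Y hY ↦ (mdifferentiableAt_const (c := a)).smul_section (hT Y hY)

theorem EndMDiffAt.comp (hT : EndMDiffAt T p) (hT' : EndMDiffAt T' p) :
    EndMDiffAt (fun q ↦ T q ∘L T' q) p :=
  fun Y hY ↦ hT _ (hT' Y hY)

variable [FiniteDimensional ℝ E] {g : PseudoMetric E M}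

variable (g) in
/-- The covariant derivative `(∇_u T) v` of a field of endomorphisms. -/
def PseudoMetric.nablaEnd (hT : EndMDiffAt T p) :
    TangentSpace 𝓘(ℝ, E) p →L[ℝ] TangentSpace 𝓘(ℝ, E) p →L[ℝ] TangentSpace 𝓘(ℝ, E) p :=
  TensorialAt.mkHom₂ (I := 𝓘(ℝ, E)) (F := E) (F' := E)
    (fun X Y ↦ g.nabla X (fun q ↦ T q (Y q)) p - T p (g.nabla X Y p)) p
    (fun Y _ ↦
      { smul := by
          intro f X _ _
          simp [PseudoMetric.nabla, smul_sub]
        add := by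
          intro X X' _ _
          simp only [PseudoMetric.nabla, Pi.add_apply, map_add]
          abel })
    (fun X _ ↦
      { smul := by
          intro f Y hf hY
          have e : (fun q ↦ T q ((f • Y) q)) = f • fun q ↦ T q (Y q) := by
            funext q
            simp
          rw [e, PseudoMetric.nabla_smul hf hY, PseudoMetric.nabla_smul hf (hT Y hY)]
          simp only [map_add, map_smul]
          module
        add := by
          intro Y Y' hY hY'
          have e : (fun q ↦ T q ((Y + Y') q)) = (fun q ↦ T q (Y q)) + fun q ↦ T q (Y' q) := by
            funext q
            simp
          rw [e, PseudoMetric.nabla_add hY hY', PseudoMetric.nabla_add (hT Y hY) (hT Y' hY')]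
          simp only [map_add]
          abel })

namespace PseudoMetric

theorem nabla_end (hT : EndMDiffAt T p) (hX : MDiffAt (T% X) p) (hY : MDiffAt (T% Y) p) :
    g.nabla X (fun q ↦ T q (Y q)) p = g.nablaEnd hT (X p) (Y p) + T p (g.nabla X Y p) := by
  rw [nablaEnd, TensorialAt.mkHom₂_apply _ _ hX hY]
  abel

theorem exists_mdifferentiableAt (u : TangentSpace 𝓘(ℝ, E) p) :
    ∃ X : Π x : M, TangentSpace 𝓘(ℝ, E) x, MDiffAt (T% X) p ∧ X p = u :=
  ⟨FiberBundle.extend E u, FiberBundle.mdifferentiableAt_extend .., by simp⟩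

theorem nablaEnd_add (hT : EndMDiffAt T p) (hT' : EndMDiffAt T' p)
    (u v : TangentSpace 𝓘(ℝ, E) p) :
    g.nablaEnd (hT.add hT') u v = g.nablaEnd hT u v + g.nablaEnd hT' u v := by
  obtain ⟨X, hX, rfl⟩ := exists_mdifferentiableAt u
  obtain ⟨Y, hY, rfl⟩ := exists_mdifferentiableAt v
  have h := nabla_end (g := g) (hT.add hT') hX hY
  have e : (fun q ↦ (T q + T' q) (Y q)) = (fun q ↦ T q (Y q)) + fun q ↦ T' q (Y q) := rfl
  rw [e, nabla_add (hT Y hY) (hT' Y hY), nabla_end hT hX hY, nabla_end hT' hX hY] at h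
  simp only [add_apply] at h
  linear_combination (norm := module) -h

theorem nablaEnd_const_smul (a : ℝ) (hT : EndMDiffAt T p) (u v : TangentSpace 𝓘(ℝ, E) p) :
    g.nablaEnd (hT.const_smul a) u v = a • g.nablaEnd hT u v := by
  obtain ⟨X, hX, rfl⟩ := exists_mdifferentiableAt u
  obtain ⟨Y, hY, rfl⟩ := exists_mdifferentiableAt v
  have h := nabla_end (g := g) (hT.const_smul a) hX hY
  have e : (fun q ↦ (a • T q) (Y q)) = a • fun q ↦ T q (Y q) := rfl
  rw [e, nabla_const_smul a (hT Y hY), nabla_end hT hX hY] at h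
  simp only [smul_apply] at h
  linear_combination (norm := module) -h

theorem nablaEnd_comp (hT : EndMDiffAt T p) (hT' : EndMDiffAt T' p)
    (u v : TangentSpace 𝓘(ℝ, E) p) : g.nablaEnd (hT.comp hT') u v
      = g.nablaEnd hT u (T' p v) + T p (g.nablaEnd hT' u v) := by
  obtain ⟨X, hX, rfl⟩ := exists_mdifferentiableAt u
  obtain ⟨Y, hY, rfl⟩ := exists_mdifferentiableAt v
  have h := nabla_end (g := g) (hT.comp hT') hX hY
  have h' := nabla_end (g := g) hT hX (hT' Y hY)
  rw [nabla_end hT' hX hY] at h'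
  simp only [ContinuousLinearMap.comp_apply, map_add] at h h'
  rw [h'] at h
  linear_combination (norm := module) -h

theorem nablaEnd_congr (hT : EndMDiffAt T p) (hT' : EndMDiffAt T' p) (h : ∀ q, T q = T' q)
    (u v : TangentSpace 𝓘(ℝ, E) p) : g.nablaEnd hT u v = g.nablaEnd hT' u v := by
  obtain rfl : T = T' := funext h
  rfl

/-- Differentiating `g(TY, Z) = g(T'Z, Y)` shows that covariant derivatives of adjoint fields are
adjoint. -/
theorem nablaEnd_adjoint (hT : EndMDiffAt T p) (hT' : EndMDiffAt T' p)
    (h : ∀ q u v, g.val q (T q u) v = g.val q (T' q v) u) (u v w : TangentSpace 𝓘(ℝ, E) p) :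
    g.val p (g.nablaEnd hT u v) w = g.val p (g.nablaEnd hT' u w) v := by
  obtain ⟨X, hX, rfl⟩ := exists_mdifferentiableAt u
  obtain ⟨Y, hY, rfl⟩ := exists_mdifferentiableAt v
  obtain ⟨Z, hZ, rfl⟩ := exists_mdifferentiableAt w
  have e : g.pair (fun q ↦ T q (Y q)) Z = g.pair (fun q ↦ T' q (Z q)) Y :=
    funext fun q ↦ h q _ _
  have h1 := dirDeriv_pair (g := g) hX (hT Y hY) hZ
  rw [e, dirDeriv_pair hX (hT' Z hZ) hY, nabla_end hT hX hY, nabla_end hT' hX hZ] at h1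
  simp only [map_add, add_apply, h p (Y p), h p (g.nabla X Y p)] at h1
  linarith

end PseudoMetric

end Endomorphisms

/-! ### Identities valid on every contact pseudo-metric manifold. -/

section Contact

variable {E : Type*} [NormedAddCommGroup E] [NormedSpace ℝ E] [FiniteDimensional ℝ E]
  {M : Type*} [TopologicalSpace M] [ChartedSpace E M] [IsManifold 𝓘(ℝ, E) ∞ M]

namespace ContactPseudoMetric

variable (S : ContactPseudoMetric E M) (p : M) (u v w : TangentSpace 𝓘(ℝ, E) p)

theorem ε_mul_ε : S.ε * S.ε = 1 := by
  rcases S.ε_eq with h | h <;> rw [h] <;> norm_num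

/-- Since `φ²ξ = 0`, evaluating `φ³ξ` gives `φξ = η(φξ)ξ`; one more `φ` gives `η(φξ) φξ = 0`, and
either factor forces `φξ = 0`. -/
theorem φ_ξ : S.φ p (S.ξ p) = 0 := by
  have h1 : S.φ p (S.φ p (S.ξ p)) = 0 := by rw [S.φ_sq]; simp [S.η_ξ]
  have h2 := S.φ_sq p (S.φ p (S.ξ p))
  rw [h1, map_zero] at h2
  have h3 : S.φ p (S.ξ p) = S.η p (S.φ p (S.ξ p)) • S.ξ p := by
    linear_combination (norm := module) h2
  have h4 := congrArg (S.φ p) h3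
  rw [h1, map_smul] at h4
  rcases smul_eq_zero.1 h4.symm with h | h
  · rw [h3, h, zero_smul]
  · exact h

theorem η_φ : S.η p (S.φ p u) = 0 := by
  have h1 := S.φ_sq p (S.φ p u)
  have h2 := congrArg (S.φ p) (S.φ_sq p u)
  rw [h1] at h2
  simp only [map_add, map_neg, map_smul, S.φ_ξ, smul_zero, add_zero] at h2
  have h3 : S.η p (S.φ p u) • S.ξ p = 0 := by linear_combination (norm := module) h2
  have h4 := congrArg (S.η p) h3
  simpa [S.η_ξ] using h4

theorem val_ξ : S.g.val p u (S.ξ p) = S.ε * S.η p u := by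
  have h := S.compatible p u (S.ξ p)
  rw [S.φ_ξ, map_zero, S.η_ξ] at h
  linarith

theorem val_ξ_left : S.g.val p (S.ξ p) u = S.ε * S.η p u := by
  rw [S.g.symm, S.val_ξ]

theorem η_eq : S.η p u = S.ε * S.g.val p (S.ξ p) u := by
  rw [val_ξ_left, ← mul_assoc, ε_mul_ε, one_mul]

theorem φ_skew : S.g.val p (S.φ p u) v = -S.g.val p (S.φ p v) u := by
  have h := S.compatible p u (S.φ p v)
  rw [S.φ_sq, S.η_φ] at h
  simp only [map_add, map_neg, map_smul, S.val_ξ, S.η_φ, smul_eq_mul] at h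
  rw [S.g.symm p _ u]
  linarith

/-- The field of endomorphisms `X ↦ ∇_X ξ`. -/
def nablaξ : TangentSpace 𝓘(ℝ, E) p →L[ℝ] TangentSpace 𝓘(ℝ, E) p := S.g.leviCivita S.ξ p

variable {p} in
theorem nabla_ξ (X : Π x : M, TangentSpace 𝓘(ℝ, E) x) :
    S.g.nabla X S.ξ p = S.nablaξ p (X p) := rfl

theorem mdifferentiableAt_ξ : MDiffAt (T% S.ξ) p := S.smooth_ξ.contMDiffAt.mdifferentiableAt (by simp)

theorem endMDiffAt_φ : EndMDiffAt S.φ p := fun _ hY ↦ S.φField_mdiff hY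

theorem endMDiffAt_nablaξ : EndMDiffAt S.nablaξ p :=
  fun _ hY ↦ S.g.nabla_mdifferentiableAt hY S.smooth_ξ.contMDiffAt

variable {p} in
theorem φField_smooth {X : Π x : M, TangentSpace 𝓘(ℝ, E) x} (hX : CMDiffAt ∞ (T% X) p) :
    CMDiffAt ∞ (T% (S.φField X)) p :=
  ContMDiffAt.clm_bundle_apply (F₁ := E) (F₂ := E) S.smooth_φ.contMDiffAt hX

section

variable {p} {X Y : Π x : M, TangentSpace 𝓘(ℝ, E) x}

theorem mdifferentiableAt_η (hY : MDiffAt (T% Y) p) :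
    MDifferentiableAt 𝓘(ℝ, E) 𝓘(ℝ, ℝ) (fun q ↦ S.η q (Y q)) p := by
  rw [show (fun q ↦ S.η q (Y q)) = (fun _ ↦ S.ε) * S.g.pair S.ξ Y from funext fun q ↦ S.η_eq q _]
  exact mdifferentiableAt_const.mul (S.g.pair_mdiff (S.mdifferentiableAt_ξ p) hY)

theorem dirDeriv_η (hX : MDiffAt (T% X) p) (hY : MDiffAt (T% Y) p) :
    dirDeriv X (fun q ↦ S.η q (Y q)) p
      = S.ε * S.g.val p (S.nablaξ p (X p)) (Y p) + S.η p (S.g.nabla X Y p) := by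
  have h := PseudoMetric.dirDeriv_pair (g := S.g) hX (S.mdifferentiableAt_ξ p) hY
  rw [nabla_ξ] at h
  rw [show (fun q ↦ S.η q (Y q)) = (fun _ ↦ S.ε) * S.g.pair S.ξ Y from funext fun q ↦ S.η_eq q _,
    S.η_eq, ← mul_add, ← h]
  simp only [dirDeriv,
    mvfderiv_mul mdifferentiableAt_const (S.g.pair_mdiff (S.mdifferentiableAt_ξ p) hY),
    mvfderiv_const]
  simp

end

/-- This is the contact condition: with `η = ε g(ξ, ·)` and no torsion, `2 dη(X, Y)` is `ε` times
the skew part of `∇ξ`. -/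
theorem nablaξ_skew : S.g.val p (S.nablaξ p u) v - S.g.val p (S.nablaξ p v) u
    = 2 * S.ε * S.g.val p u (S.φ p v) := by
  obtain ⟨X, hX, rfl⟩ := PseudoMetric.exists_mdifferentiableAt u
  obtain ⟨Y, hY, rfl⟩ := PseudoMetric.exists_mdifferentiableAt v
  have h := S.contact X Y p hX hY
  rw [oneFormDeriv, S.dirDeriv_η hX hY, S.dirDeriv_η hY hX,  PseudoMetric.torsion_free (g := S.g) hX hY] at h
  simp only [map_sub] at h
  linear_combination 2 * S.ε * h - (S.g.val p (S.nablaξ p (X p)) (Y p)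
    - S.g.val p (S.nablaξ p (Y p)) (X p)) * S.ε_mul_ε

theorem val_nablaξ_ξ : S.g.val p (S.nablaξ p u) (S.ξ p) = 0 := by
  obtain ⟨X, hX, rfl⟩ := PseudoMetric.exists_mdifferentiableAt u
  have hξ := S.mdifferentiableAt_ξ p
  have h := PseudoMetric.dirDeriv_pair (g := S.g) hX hξ hξ
  have e : S.g.pair S.ξ S.ξ = fun _ ↦ S.ε := by
    funext q
    simp [PseudoMetric.pair, S.val_ξ, S.η_ξ]
  rw [e, nabla_ξ, S.g.symm p (S.ξ p)] at h
  simp only [dirDeriv, mvfderiv_const] at h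
  simp only [zero_apply] at h
  linarith

theorem η_nablaξ : S.η p (S.nablaξ p u) = 0 := by
  rw [η_eq, S.g.symm, val_nablaξ_ξ, mul_zero]

theorem nablaξ_ξ : S.nablaξ p (S.ξ p) = 0 := by
  refine S.g.nondegenerate p _ fun w ↦ ?_
  have h := S.nablaξ_skew p (S.ξ p) w
  rw [S.val_nablaξ_ξ, S.val_ξ_left, S.η_φ] at h
  linarith

/-- The covariant derivative `(∇_u φ) v`. -/
def nablaφ : TangentSpace 𝓘(ℝ, E) p →L[ℝ] TangentSpace 𝓘(ℝ, E) p →L[ℝ] TangentSpace 𝓘(ℝ, E) p :=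
  S.g.nablaEnd (S.endMDiffAt_φ p)

/-- The second covariant derivative `(∇_u (∇ ξ)) v` of `ξ`. -/
def nabla₂ξ : TangentSpace 𝓘(ℝ, E) p →L[ℝ] TangentSpace 𝓘(ℝ, E) p →L[ℝ] TangentSpace 𝓘(ℝ, E) p :=
  S.g.nablaEnd (S.endMDiffAt_nablaξ p)

theorem nablaφ_skew : S.g.val p (S.nablaφ p u v) w = -S.g.val p (S.nablaφ p u w) v := by
  have h := S.g.nablaEnd_adjoint (S.endMDiffAt_φ p) ((S.endMDiffAt_φ p).const_smul (-1))
    (fun q u v ↦ by rw [S.φ_skew]; simp) u v w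
  rw [PseudoMetric.nablaEnd_const_smul] at h
  simpa [nablaφ] using h

/-- By `nablaξ_skew` the adjoint of `∇ξ` is `∇ξ + 2εφ`; this relation is differentiated. -/
theorem nabla₂ξ_skew : S.g.val p (S.nabla₂ξ p u v) w - S.g.val p (S.nabla₂ξ p u w) v
    = -2 * S.ε * S.g.val p (S.nablaφ p u v) w := by
  have h := S.g.nablaEnd_adjoint (S.endMDiffAt_nablaξ p)
    ((S.endMDiffAt_nablaξ p).add ((S.endMDiffAt_φ p).const_smul (2 * S.ε)))
    (fun q u v ↦ by
      have h := S.nablaξ_skew q u v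
      rw [S.g.symm q u] at h
      simp
      linarith) u v w
  rw [PseudoMetric.nablaEnd_add (S.endMDiffAt_nablaξ p) ((S.endMDiffAt_φ p).const_smul (2 * S.ε)),
    PseudoMetric.nablaEnd_const_smul (2 * S.ε) (S.endMDiffAt_φ p)] at h
  have h' := S.nablaφ_skew p u v w
  simp only [map_add, map_smul, add_apply, smul_apply, smul_eq_mul] at h
  simp only [nablaφ, nabla₂ξ] at *
  linear_combination h + 2 * S.ε * h'

theorem nablaφ_ξ : S.nablaφ p u (S.ξ p) = -S.φ p (S.nablaξ p u) := by
  obtain ⟨X, hX, rfl⟩ := PseudoMetric.exists_mdifferentiableAt u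
  have h := PseudoMetric.nabla_end (g := S.g) (S.endMDiffAt_φ p) hX (S.mdifferentiableAt_ξ p)
  have e : (fun q ↦ S.φ q (S.ξ q)) = 0 := funext fun q ↦ S.φ_ξ q
  rw [e, nabla_ξ] at h
  simp only [PseudoMetric.nabla, CovariantDerivative.zero] at h
  exact eq_neg_of_add_eq_zero_left (by simpa [nablaφ] using h.symm)

theorem nabla₂ξ_ξ : S.nabla₂ξ p u (S.ξ p) = -S.nablaξ p (S.nablaξ p u) := by
  obtain ⟨X, hX, rfl⟩ := PseudoMetric.exists_mdifferentiableAt u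
  have h := PseudoMetric.nabla_end (g := S.g) (S.endMDiffAt_nablaξ p) hX (S.mdifferentiableAt_ξ p)
  have e : (fun q ↦ S.nablaξ q (S.ξ q)) = 0 := funext fun q ↦ S.nablaξ_ξ q
  rw [e, nabla_ξ] at h
  simp only [PseudoMetric.nabla, CovariantDerivative.zero] at h
  exact eq_neg_of_add_eq_zero_left (by simpa [nabla₂ξ] using h.symm)

theorem riemann_ξ : S.g.riemann p u v (S.ξ p) = S.nabla₂ξ p u v - S.nabla₂ξ p v u := by
  have hX := smooth_extend u
  have hY := smooth_extend v
  have h := S.g.curvature_eq_riemann hX hY (S.smooth_ξ.contMDiffAt (x := p))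
  simp only [FiberBundle.extend_apply_self] at h
  have dX := hX.mdifferentiableAt (n := ∞) (by simp)
  have dY := hY.mdifferentiableAt (n := ∞) (by simp)
  rw [← h, PseudoMetric.curvature_apply, nabla_ξ, PseudoMetric.torsion_free (g := S.g) dX dY]
  have e : ∀ X : Π x : M, TangentSpace 𝓘(ℝ, E) x,
      S.g.nabla X S.ξ = fun q ↦ S.nablaξ q (X q) := fun X ↦ rfl
  rw [e, e, PseudoMetric.nabla_end (S.endMDiffAt_nablaξ p) dX dY,
    PseudoMetric.nabla_end (S.endMDiffAt_nablaξ p) dY dX]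
  simp only [FiberBundle.extend_apply_self, map_sub, nabla₂ξ]
  abel

/-- This expresses that `dη` is closed. It is derived here from the first Bianchi identity paired
with `ξ`, where `R(u, v)ξ` is the alternation of the second derivative of `ξ`. -/
theorem nablaφ_cyclic : S.g.val p (S.nablaφ p u v) w + S.g.val p (S.nablaφ p v w) u
    + S.g.val p (S.nablaφ p w u) v = 0 := by
  have r : ∀ u v w, S.g.val p (S.g.riemann p u v w) (S.ξ p)
      = -(S.g.val p (S.nabla₂ξ p u v) w - S.g.val p (S.nabla₂ξ p v u) w) := by
    intro u v w
    rw [PseudoMetric.val_riemann_skew, riemann_ξ]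
    simp
  have b := congrArg (fun z ↦ S.g.val p z (S.ξ p)) (S.g.riemann_bianchi u v w)
  simp only [map_add, add_apply, map_zero, zero_apply, r] at b
  have s1 := S.nabla₂ξ_skew p u v w
  have s2 := S.nabla₂ξ_skew p v w u
  have s3 := S.nabla₂ξ_skew p w u v
  have : -2 * S.ε * (S.g.val p (S.nablaφ p u v) w + S.g.val p (S.nablaφ p v w) u
    + S.g.val p (S.nablaφ p w u) v) = 0 := by linarith
  refine (mul_eq_zero.1 this).resolve_left ?_
  rcases S.ε_eq with h | h <;> rw [h] <;> norm_num

/-- The derivative of `φ² = -1 + η ⊗ ξ`. -/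
theorem nablaφ_φ : S.nablaφ p u (S.φ p v) + S.φ p (S.nablaφ p u v)
    = S.η p v • S.nablaξ p u + (S.ε * S.g.val p (S.nablaξ p u) v) • S.ξ p := by
  obtain ⟨X, hX, rfl⟩ := PseudoMetric.exists_mdifferentiableAt u
  obtain ⟨Y, hY, rfl⟩ := PseudoMetric.exists_mdifferentiableAt v
  have hφ := S.endMDiffAt_φ p
  have hξ := S.mdifferentiableAt_ξ p
  have hη := S.mdifferentiableAt_η hY
  have e : (fun q ↦ S.φ q (S.φ q (Y q))) = -Y + (fun q ↦ S.η q (Y q)) • S.ξ := by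
    funext q
    simp [S.φ_sq]
  have h := PseudoMetric.nabla_end (g := S.g) hφ hX (hφ Y hY)
  rw [e, PseudoMetric.nabla_end hφ hX hY, PseudoMetric.nabla_add (mdifferentiableAt_neg_section hY)
    (hη.smul_section hξ), PseudoMetric.nabla_neg hY, PseudoMetric.nabla_smul hη hξ, nabla_ξ,
    S.dirDeriv_η hX hY, map_add, S.φ_sq] at h
  simp only [nablaφ]
  linear_combination (norm := module) -h

theorem h_eq : S.h p u = (1 / 2 : ℝ) • (S.nablaφ p (S.ξ p) u - S.nablaξ p (S.φ p u)
    + S.φ p (S.nablaξ p u)) := by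
  obtain ⟨X, hX, rfl⟩ := PseudoMetric.exists_mdifferentiableAt u
  have hξ := S.mdifferentiableAt_ξ p
  rw [S.h_apply hX, lieDerivφ, PseudoMetric.torsion_free (g := S.g) hξ hX,
    PseudoMetric.torsion_free (g := S.g) hξ (S.φField_mdiff hX), nabla_ξ, nabla_ξ]
  rw [show S.φField X = fun q ↦ S.φ q (X q) from rfl, PseudoMetric.nabla_end (S.endMDiffAt_φ p) hξ hX]
  simp only [map_sub, nablaφ]
  congr 1
  abel

end ContactPseudoMetric

end Contact

/-! ### The symmetric part `B` of `∇ξ`, and its relation to `h`. -/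

section Symmetric

variable {E : Type*} [NormedAddCommGroup E] [NormedSpace ℝ E] [FiniteDimensional ℝ E]
  {M : Type*} [TopologicalSpace M] [ChartedSpace E M] [IsManifold 𝓘(ℝ, E) ∞ M]

namespace ContactPseudoMetric

variable (S : ContactPseudoMetric E M) (p : M) (u v w : TangentSpace 𝓘(ℝ, E) p)

/-- The cyclic identity with one entry `ξ` reduces `∇_ξ φ` to derivatives of the form `(∇_u φ)ξ =
-φ∇_u ξ`. -/
theorem nablaφ_ξ_left_eq : S.nablaφ p (S.ξ p) u = -S.φ p (S.nablaξ p u) - S.nablaξ p (S.φ p u)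
    - (2 * S.ε) • S.φ p (S.φ p u) := by
  refine sub_eq_zero.1 (S.g.nondegenerate p _ fun z ↦ ?_)
  have h1 := S.nablaφ_cyclic p (S.ξ p) u z
  have h2 := S.nablaφ_skew p u z (S.ξ p)
  rw [S.nablaφ_ξ] at h1 h2
  have h3 := S.φ_skew p (S.nablaξ p z) u
  have h4 := S.nablaξ_skew p z (S.φ p u)
  rw [S.g.symm p z] at h4
  simp only [map_sub, map_neg, map_smul, sub_apply, neg_apply, smul_apply, smul_eq_mul] at *
  linear_combination h1 - h2 + h3 - h4 + S.g.symm p (S.nablaξ p z) (S.φ p u)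

/-- As `∇_ξ ξ = 0`, `nablaφ_φ` says that `∇_ξ φ` anticommutes with `φ`. Inserting `nablaφ_ξ_left_eq`
into this relation and solving for `∇ξ` gives the formula. -/
theorem nablaξ_eq : S.nablaξ p u = S.φ p (S.nablaξ p (S.φ p u)) - (2 * S.ε) • S.φ p u := by
  have h := S.nablaφ_φ p (S.ξ p) u
  rw [S.nablaφ_ξ_left_eq, S.nablaφ_ξ_left_eq, S.nablaξ_ξ] at h
  simp only [map_sub, map_neg, map_smul, map_add, S.φ_sq, S.η_nablaξ, S.nablaξ_ξ, S.φ_ξ,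
    zero_smul, map_zero, add_zero, smul_zero, zero_apply, mul_zero, smul_neg, neg_neg] at h
  have h2 : (2 : ℝ) • S.nablaξ p u
      = (2 : ℝ) • (S.φ p (S.nablaξ p (S.φ p u)) - (2 * S.ε) • S.φ p u) := by
    linear_combination (norm := module) h
  exact smul_right_injective _ two_ne_zero h2

theorem φ_nablaξ : S.φ p (S.nablaξ p u)
    = -S.nablaξ p (S.φ p u) - (2 * S.ε) • S.φ p (S.φ p u) := by
  conv_lhs => rw [nablaξ_eq]
  rw [map_sub, S.φ_sq, S.η_nablaξ, map_smul]
  simp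

theorem nablaφ_ξ_left : S.nablaφ p (S.ξ p) = 0 := by
  ext u
  rw [nablaφ_ξ_left_eq, φ_nablaξ]
  simp

/-- The symmetric part of the field of endomorphisms `X ↦ ∇_X ξ`. -/
def symξ : TangentSpace 𝓘(ℝ, E) p →L[ℝ] TangentSpace 𝓘(ℝ, E) p := S.nablaξ p + S.ε • S.φ p

theorem nablaξ_apply : S.nablaξ p u = S.symξ p u - S.ε • S.φ p u := by
  simp [symξ]

theorem symξ_symm : S.g.val p (S.symξ p u) v = S.g.val p (S.symξ p v) u := by
  have h := S.nablaξ_skew p u v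
  have h' := S.φ_skew p u v
  rw [S.g.symm p u] at h
  simp only [symξ, map_add, map_smul, add_apply, smul_apply, smul_eq_mul]
  linear_combination h + S.ε * h'

theorem symξ_ξ : S.symξ p (S.ξ p) = 0 := by
  simp [symξ, S.nablaξ_ξ, S.φ_ξ]

theorem η_symξ : S.η p (S.symξ p u) = 0 := by
  simp [symξ, S.η_nablaξ, S.η_φ]

theorem symξ_φ : S.symξ p (S.φ p u) = -S.φ p (S.symξ p u) := by
  simp only [symξ, add_apply, smul_apply, map_add, map_smul, φ_nablaξ]
  module

theorem h_eq_φ_symξ : S.h p u = S.φ p (S.symξ p u) := by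
  rw [S.h_eq, S.nablaφ_ξ_left]
  have h := S.symξ_φ p u
  simp only [symξ, add_apply, smul_apply, map_add, map_smul, zero_apply] at *
  have h2 : S.nablaξ p (S.φ p u) = -S.φ p (S.nablaξ p u) - (2 * S.ε) • S.φ p (S.φ p u) := by
    linear_combination (norm := module) h
  rw [h2]
  module

theorem h_ξ : S.h p (S.ξ p) = 0 := by
  rw [h_eq_φ_symξ, symξ_ξ, map_zero]

theorem endMDiffAt_symξ : EndMDiffAt S.symξ p :=
  (S.endMDiffAt_nablaξ p).add ((S.endMDiffAt_φ p).const_smul S.ε)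

variable {p} in
theorem symξ_smooth {X : Π x : M, TangentSpace 𝓘(ℝ, E) x} (hX : CMDiffAt ∞ (T% X) p) :
    CMDiffAt ∞ (T% (fun q ↦ S.symξ q (X q))) p :=
  (S.g.nabla_smooth hX S.smooth_ξ.contMDiffAt).add_section
    ((contMDiffAt_const (c := S.ε)).smul_section (S.φField_smooth hX))

/-- The covariant derivative of the field `S.symξ`. -/
def nablaSymξ : TangentSpace 𝓘(ℝ, E) p →L[ℝ] TangentSpace 𝓘(ℝ, E) p →L[ℝ] TangentSpace 𝓘(ℝ, E) p :=
  S.g.nablaEnd (S.endMDiffAt_symξ p)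

theorem nablaSymξ_eq : S.nablaSymξ p u v = S.nabla₂ξ p u v + S.ε • S.nablaφ p u v := by
  have h := PseudoMetric.nablaEnd_add (g := S.g) (S.endMDiffAt_nablaξ p)
    ((S.endMDiffAt_φ p).const_smul S.ε) u v
  rw [PseudoMetric.nablaEnd_const_smul S.ε (S.endMDiffAt_φ p)] at h
  exact h

theorem nablaSymξ_symm : S.g.val p (S.nablaSymξ p u v) w = S.g.val p (S.nablaSymξ p u w) v :=
  S.g.nablaEnd_adjoint _ _ (fun q ↦ S.symξ_symm q) u v w

theorem nablaSymξ_ξ : S.nablaSymξ p u (S.ξ p) = -S.symξ p (S.nablaξ p u) := by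
  rw [nablaSymξ_eq, nabla₂ξ_ξ, nablaφ_ξ, symξ]
  simp
  abel

theorem val_nablaSymξ_ξ : S.g.val p (S.nablaSymξ p u v) (S.ξ p)
    = -S.g.val p (S.symξ p (S.nablaξ p u)) v := by
  rw [nablaSymξ_symm, nablaSymξ_ξ]
  simp

theorem riemann_ξ_eq_nablaSymξ : S.g.riemann p u v (S.ξ p) = S.nablaSymξ p u v - S.nablaSymξ p v u
    - S.ε • (S.nablaφ p u v - S.nablaφ p v u) := by
  rw [riemann_ξ, nablaSymξ_eq, nablaSymξ_eq]
  module

/-- The derivative of `Bφ + φB = 0`. -/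
theorem nablaSymξ_φ : S.nablaφ p u (S.symξ p v) + S.φ p (S.nablaSymξ p u v)
    + S.nablaSymξ p u (S.φ p v) + S.symξ p (S.nablaφ p u v) = 0 := by
  have hB := S.endMDiffAt_symξ p
  have hφ := S.endMDiffAt_φ p
  have h := S.g.nablaEnd_congr (hB.comp hφ) ((hφ.comp hB).const_smul (-1)) (fun q ↦ by
    ext u
    simp [S.symξ_φ q]) u v
  rw [PseudoMetric.nablaEnd_const_smul (-1) (hφ.comp hB), PseudoMetric.nablaEnd_comp hφ hB,
    PseudoMetric.nablaEnd_comp hB hφ] at h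
  simp only [nablaφ, nablaSymξ]
  linear_combination (norm := module) h

/-! ### Consequences of the nullity condition. -/

section KappaMu

variable {S} {κ μ : ℝ} (hS : S.IsKappaMu κ μ)

include hS

theorem IsKappaMu.riemann_ξ : S.g.riemann p u v (S.ξ p)
    = (S.ε * κ) • (S.η p v • u - S.η p u • v)
      + (S.ε * μ) • (S.η p v • S.h p u - S.η p u • S.h p v) := by
  have hX := smooth_extend u
  have hY := smooth_extend v
  have h := S.g.curvature_eq_riemann hX hY (S.smooth_ξ.contMDiffAt (x := p))
  rw [hS _ _ p hX hY] at h
  simpa using h.symm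

/-- The nullity condition for `R(ξ, u)ξ`, solved for `(∇_ξ B)u`. -/
theorem IsKappaMu.nablaSymξ_ξ_left_aux : S.nablaSymξ p (S.ξ p) u
    = (S.ε * κ) • S.φ p (S.φ p u) - (S.ε * μ) • S.h p u - S.symξ p (S.symξ p u)
      - S.φ p (S.φ p u) := by
  have h := IsKappaMu.riemann_ξ p (S.ξ p) u hS
  rw [riemann_ξ_eq_nablaSymξ, nablaφ_ξ_left, nablaφ_ξ, nablaSymξ_ξ, S.η_ξ, S.h_ξ] at h
  simp only [nablaξ_apply, map_sub, map_smul, S.symξ_φ, zero_apply] at h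
  have hφ := S.φ_sq p u
  have e : S.ε • S.ε • S.φ p (S.φ p u) = S.φ p (S.φ p u) := by
    rw [smul_smul, S.ε_mul_ε, one_smul]
  linear_combination (norm := module) h - e - (S.ε * κ) • hφ

/-- Since `∇_ξ φ = 0`, `∇_ξ B` anticommutes with `φ`, and so does its `h` term. The remaining terms
commute with `φ`, so their sum is killed by `φ`. -/
theorem IsKappaMu.symξ_symξ : S.symξ p (S.symξ p u) = (S.ε * κ - 1) • S.φ p (S.φ p u) := by
  have h := S.nablaSymξ_φ p (S.ξ p) u
  rw [S.nablaφ_ξ_left, hS.nablaSymξ_ξ_left_aux, hS.nablaSymξ_ξ_left_aux] at h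
  simp only [S.h_eq_φ_symξ, S.symξ_φ, map_sub, map_smul, map_neg, neg_neg, zero_apply, map_zero,
    zero_add, add_zero] at h
  have h1 : S.φ p (S.symξ p (S.symξ p u) - (S.ε * κ - 1) • S.φ p (S.φ p u)) = 0 := by
    simp only [map_sub, map_smul]
    linear_combination (norm := module) (-1 / 2 : ℝ) • h
  -- A vector annihilated by both `φ` and `η` is zero, because `φ² = -1 + η ⊗ ξ`.
  have h2 := S.φ_sq p (S.symξ p (S.symξ p u) - (S.ε * κ - 1) • S.φ p (S.φ p u))
  rw [h1, map_zero, map_sub, S.η_symξ, map_smul, S.η_φ] at h2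
  simp only [smul_zero, sub_zero, zero_smul, add_zero] at h2
  exact sub_eq_zero.1 (neg_eq_zero.1 h2.symm)

theorem IsKappaMu.nablaSymξ_ξ_left : S.nablaSymξ p (S.ξ p) u = -(S.ε * μ) • S.h p u := by
  rw [hS.nablaSymξ_ξ_left_aux, hS.symξ_symξ]
  module

theorem IsKappaMu.nablaSymξ_symξ : S.nablaSymξ p u (S.symξ p v) + S.symξ p (S.nablaSymξ p u v)
    = (S.ε * κ - 1) • (S.η p v • S.nablaξ p u + (S.ε * S.g.val p (S.nablaξ p u) v) • S.ξ p) := by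
  have hB := S.endMDiffAt_symξ p
  have hφ := S.endMDiffAt_φ p
  have h := S.g.nablaEnd_congr (hB.comp hB) ((hφ.comp hφ).const_smul (S.ε * κ - 1)) (fun q ↦ by
    ext u
    exact hS.symξ_symξ q u) u v
  rw [PseudoMetric.nablaEnd_const_smul _ (hφ.comp hφ), PseudoMetric.nablaEnd_comp hφ hφ,
    PseudoMetric.nablaEnd_comp hB hB] at h
  rw [← nablaφ_φ]
  exact h

/-! ### Vanishing of the horizontal parts of `∇φ` and `∇B`. -/

section Eigenvectors

variable {p u v w} {ℓ : ℝ}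

/-- A horizontal eigenvector of `S.symξ`. -/
def IsSymEigen (S : ContactPseudoMetric E M) (ℓ : ℝ) (u : TangentSpace 𝓘(ℝ, E) p) : Prop :=
  S.η p u = 0 ∧ S.symξ p u = ℓ • u

omit hS in
theorem IsSymEigen.φ (hu : S.IsSymEigen ℓ u) : S.IsSymEigen (-ℓ) (S.φ p u) := by
  refine ⟨S.η_φ p u, ?_⟩
  rw [S.symξ_φ, hu.2, map_smul, neg_smul]

omit hS in
theorem IsSymEigen.exists_φ (hu : S.IsSymEigen (-ℓ) u) : ∃ v, S.IsSymEigen ℓ v ∧ S.φ p v = u := by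
  refine ⟨-S.φ p u, ?_, ?_⟩
  · have h := hu.φ
    rw [neg_neg] at h
    exact ⟨by rw [map_neg, h.1, neg_zero], by rw [map_neg, h.2, smul_neg]⟩
  · rw [map_neg, S.φ_sq, hu.1]
    simp

theorem IsKappaMu.exists_isSymEigen (hℓ : ℓ ≠ 0) (hℓ2 : ℓ ^ 2 = 1 - S.ε * κ) (hu : S.η p u = 0) :
    ∃ a b, S.IsSymEigen ℓ a ∧ S.IsSymEigen (-ℓ) b ∧ u = a + b := by
  have hB : S.symξ p (S.symξ p u) = ℓ ^ 2 • u := by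
    rw [hS.symξ_symξ, S.φ_sq, hu, hℓ2]
    module
  refine ⟨(1 / 2 : ℝ) • (u + ℓ⁻¹ • S.symξ p u), (1 / 2 : ℝ) • (u - ℓ⁻¹ • S.symξ p u),
    ⟨?_, ?_⟩, ⟨?_, ?_⟩, by module⟩
  · simp [hu, S.η_symξ]
  · simp only [map_smul, map_add, hB, smul_smul, smul_add]
    rw [show 1 / 2 * ℓ⁻¹ * ℓ ^ 2 = ℓ * (1 / 2) by field_simp,
      show ℓ * (1 / 2 * ℓ⁻¹) = 1 / 2 by field_simp]
    abel
  · simp [hu, S.η_symξ]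
  · simp only [map_smul, map_sub, hB, smul_smul, smul_sub]
    rw [show 1 / 2 * ℓ⁻¹ * ℓ ^ 2 = ℓ * (1 / 2) by field_simp,
      show -ℓ * (1 / 2 * ℓ⁻¹) = -(1 / 2) by field_simp]
    module

omit hS in
theorem val_nablaφ_φ (hv : S.η p v = 0) (hw : S.η p w = 0) :
    S.g.val p (S.nablaφ p u (S.φ p v)) w = S.g.val p (S.nablaφ p u v) (S.φ p w) := by
  have h := congrArg (fun z ↦ S.g.val p z w) (S.nablaφ_φ p u v)
  simp only [map_add, map_smul, add_apply, smul_apply, hv, S.val_ξ_left, hw, zero_smul, zero_apply,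
    map_zero, smul_eq_mul, mul_zero, add_zero] at h
  rw [S.φ_skew, S.g.symm p (S.φ p w)] at h
  linarith

/-- For horizontal `u, v` the nullity condition reads `R(u, v)ξ = 0`; the cyclic identity collapses
the two `∇φ` terms into one. -/
theorem IsKappaMu.val_riemann_ξ (hu : S.η p u = 0) (hv : S.η p v = 0) :
    S.g.val p (S.nablaSymξ p u v) w - S.g.val p (S.nablaSymξ p v u) w
      + S.ε * S.g.val p (S.nablaφ p w u) v = 0 := by
  have h := hS.riemann_ξ p u v
  rw [riemann_ξ_eq_nablaSymξ, hu, hv] at h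
  have h' := congrArg (fun z ↦ S.g.val p z w) h
  simp only [map_add, map_sub, map_smul, add_apply, sub_apply, smul_apply, zero_smul, sub_zero,
    smul_zero, map_zero, zero_apply, smul_eq_mul] at h'
  linear_combination h' + S.ε * (S.nablaφ_cyclic p u v w) - S.ε * (S.nablaφ_skew p v w u)

/-- On horizontal vectors `B²` is a constant multiple of the identity, so `∇_u B` anticommutes with
`B` up to a multiple of `ξ`. Pairing two `ℓ`-eigenvectors gives `2ℓ` times the value. -/
theorem IsKappaMu.val_nablaSymξ_eq_zero (hℓ : ℓ ≠ 0) (hv : S.IsSymEigen ℓ v)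
    (hw : S.IsSymEigen ℓ w) : S.g.val p (S.nablaSymξ p u v) w = 0 := by
  have h := congrArg (fun z ↦ S.g.val p z w) (hS.nablaSymξ_symξ p u v)
  simp only [map_add, map_smul, add_apply, smul_apply, hv.1, hv.2, S.val_ξ_left, hw.1, zero_smul,
    zero_apply, map_zero, smul_eq_mul, mul_zero, add_zero] at h
  rw [S.symξ_symm, hw.2] at h
  simp only [map_smul, smul_apply, smul_eq_mul] at h
  rw [S.g.symm p w] at h
  have : 2 * ℓ * S.g.val p (S.nablaSymξ p u v) w = 0 := by linarith
  simpa [hℓ] using this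

/-- In `val_riemann_ξ` for `v, w, u`, symmetry of `∇B` puts two `ℓ`-eigenvectors in its last two
slots, so only the `∇φ` term survives. -/
theorem IsKappaMu.val_nablaφ_isSymEigen (hℓ : ℓ ≠ 0) (hu : S.IsSymEigen ℓ u)
    (hv : S.IsSymEigen ℓ v) (hw : S.IsSymEigen ℓ w) : S.g.val p (S.nablaφ p u v) w = 0 := by
  have h := hS.val_riemann_ξ (w := u) hv.1 hw.1
  rw [S.nablaSymξ_symm p v w u, S.nablaSymξ_symm p w v u] at h
  rw [hS.val_nablaSymξ_eq_zero hℓ hu hw, hS.val_nablaSymξ_eq_zero hℓ hu hv] at h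
  have hε : S.ε ≠ 0 := by rcases S.ε_eq with h | h <;> rw [h] <;> norm_num
  simpa [hε] using h

theorem IsKappaMu.val_nablaφ_isSymEigen_neg (hℓ : ℓ ≠ 0) (hu : S.IsSymEigen ℓ u)
    (hv : S.IsSymEigen (-ℓ) v) (hw : S.IsSymEigen (-ℓ) w) :
    S.g.val p (S.nablaφ p u v) w = 0 := by
  obtain ⟨v, hv', rfl⟩ := hv.exists_φ
  rw [val_nablaφ_φ hv'.1 hw.1]
  exact hS.val_nablaφ_isSymEigen hℓ hu hv' (by simpa using hw.φ)

/-- On the `ℓ`-eigenspace the trilinear form `g((∇_u φ)v, φw)` is symmetric in `u, v` and skew in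
`v, w`; such a form vanishes. -/
theorem IsKappaMu.val_nablaφ_isSymEigen_mixed (hℓ : ℓ ≠ 0) (hu : S.IsSymEigen ℓ u)
    (hv : S.IsSymEigen ℓ v) (hw : S.IsSymEigen (-ℓ) w) :
    S.g.val p (S.nablaφ p u v) w = 0 := by
  obtain ⟨w, hw', rfl⟩ := hw.exists_φ
  have symm : ∀ {u v w : TangentSpace 𝓘(ℝ, E) p}, S.IsSymEigen ℓ u → S.IsSymEigen ℓ v →
      S.IsSymEigen ℓ w →
      S.g.val p (S.nablaφ p u v) (S.φ p w) = S.g.val p (S.nablaφ p v u) (S.φ p w) := by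
    intro u v w hu hv hw
    have h := S.nablaφ_cyclic p u v (S.φ p w)
    rw [hS.val_nablaφ_isSymEigen_neg (neg_ne_zero.2 hℓ) hw.φ (by simpa using hu)
      (by simpa using hv), S.nablaφ_skew p v _ u] at h
    linarith
  have skew : ∀ {u v w : TangentSpace 𝓘(ℝ, E) p}, S.IsSymEigen ℓ v → S.IsSymEigen ℓ w →
      S.g.val p (S.nablaφ p u v) (S.φ p w) = -S.g.val p (S.nablaφ p u w) (S.φ p v) := by
    intro u v w hv hw
    rw [← val_nablaφ_φ hv.1 hw.1, S.nablaφ_skew]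
  -- Alternating the two exchanges six times returns to the initial arguments with the opposite
  -- sign.
  have h1 := skew (u := u) hv hw'
  have h2 := symm hu hw' hv
  have h3 := skew (u := w) hu hv
  have h4 := symm hw' hv hu
  have h5 := skew (u := v) hw' hu
  have h6 := symm hv hu hw'
  linarith

theorem IsKappaMu.val_nablaφ_eq_zero (hκ : S.ε * κ < 1) (hu : S.η p u = 0) (hv : S.η p v = 0)
    (hw : S.η p w = 0) : S.g.val p (S.nablaφ p u v) w = 0 := by
  have hpos : 0 < 1 - S.ε * κ := by linarith
  have key : ∀ {ℓ : ℝ} {u v w : TangentSpace 𝓘(ℝ, E) p}, ℓ ≠ 0 → ℓ ^ 2 = 1 - S.ε * κ →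
      S.IsSymEigen ℓ u → S.η p v = 0 → S.η p w = 0 → S.g.val p (S.nablaφ p u v) w = 0 := by
    intro ℓ u v w hℓ hℓ2 hu hv hw
    obtain ⟨a, b, ha, hb, rfl⟩ := hS.exists_isSymEigen hℓ hℓ2 hv
    obtain ⟨c, d, hc, hd, rfl⟩ := hS.exists_isSymEigen hℓ hℓ2 hw
    have h := S.nablaφ_skew p u b c
    rw [hS.val_nablaφ_isSymEigen_mixed hℓ hu hc hb] at h
    simp [hS.val_nablaφ_isSymEigen hℓ hu ha hc, hS.val_nablaφ_isSymEigen_neg hℓ hu hb hd,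
      hS.val_nablaφ_isSymEigen_mixed hℓ hu ha hd, h]
  have hℓ : √(1 - S.ε * κ) ≠ 0 := (Real.sqrt_pos.2 hpos).ne'
  have hℓ2 : √(1 - S.ε * κ) ^ 2 = 1 - S.ε * κ := Real.sq_sqrt hpos.le
  obtain ⟨a, b, ha, hb, rfl⟩ := hS.exists_isSymEigen hℓ hℓ2 hu
  simp [key hℓ hℓ2 ha hv hw, key (neg_ne_zero.2 hℓ) (by rw [neg_sq, hℓ2]) hb hv hw]

/-- Once `∇φ` drops out of `val_riemann_ξ`, `g((∇_u B)v, w)` is totally symmetric. Of three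
eigenvectors two share an eigenvalue, and they can be moved to the last two slots. -/
theorem IsKappaMu.val_nablaSymξ_horizontal (hκ : S.ε * κ < 1) (hu : S.η p u = 0)
    (hv : S.η p v = 0) (hw : S.η p w = 0) : S.g.val p (S.nablaSymξ p u v) w = 0 := by
  have hpos : 0 < 1 - S.ε * κ := by linarith
  have symm : ∀ {u v w : TangentSpace 𝓘(ℝ, E) p}, S.η p u = 0 → S.η p v = 0 → S.η p w = 0 →
      S.g.val p (S.nablaSymξ p u v) w = S.g.val p (S.nablaSymξ p v u) w := by
    intro u v w hu hv hw
    have h := hS.val_riemann_ξ (w := w) hu hv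
    rw [hS.val_nablaφ_eq_zero hκ hw hu hv] at h
    linarith
  have hℓ : √(1 - S.ε * κ) ≠ 0 := (Real.sqrt_pos.2 hpos).ne'
  have hℓ2 : √(1 - S.ε * κ) ^ 2 = 1 - S.ε * κ := Real.sq_sqrt hpos.le
  have hℓ' := neg_ne_zero.2 hℓ
  obtain ⟨a, b, ha, hb, rfl⟩ := hS.exists_isSymEigen hℓ hℓ2 hu
  obtain ⟨c, d, hc, hd, rfl⟩ := hS.exists_isSymEigen hℓ hℓ2 hv
  obtain ⟨e, f, he, hf, rfl⟩ := hS.exists_isSymEigen hℓ hℓ2 hw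
  have h1 : S.g.val p (S.nablaSymξ p a c) f = 0 := by
    rw [S.nablaSymξ_symm, symm ha.1 hf.1 hc.1, hS.val_nablaSymξ_eq_zero hℓ ha hc]
  have h2 : S.g.val p (S.nablaSymξ p a d) e = 0 := by
    rw [symm ha.1 hd.1 he.1, hS.val_nablaSymξ_eq_zero hℓ ha he]
  have h3 : S.g.val p (S.nablaSymξ p b c) f = 0 := by
    rw [symm hb.1 hc.1 hf.1, hS.val_nablaSymξ_eq_zero hℓ' hb hf]
  have h4 : S.g.val p (S.nablaSymξ p b d) e = 0 := by
    rw [S.nablaSymξ_symm, symm hb.1 he.1 hd.1, hS.val_nablaSymξ_eq_zero hℓ' hb hd]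
  simp [h1, h2, h3, h4, hS.val_nablaSymξ_eq_zero hℓ hc he, hS.val_nablaSymξ_eq_zero hℓ' hd hf]

end Eigenvectors

variable (hκ : S.ε * κ < 1)

include hκ

/-- The horizontal part is zero, so only the components involving `ξ` remain, and these are known
from `∇_ξ φ = 0` and `(∇_u φ)ξ`. -/
theorem IsKappaMu.nablaφ_eq : S.nablaφ p u v
    = (S.ε * S.g.val p (S.φ p (S.nablaξ p u)) v) • S.ξ p - S.η p v • S.φ p (S.nablaξ p u) := by
  refine sub_eq_zero.1 (S.g.nondegenerate p _ fun w ↦ ?_)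
  have hor : ∀ z : TangentSpace 𝓘(ℝ, E) p, S.η p (z - S.η p z • S.ξ p) = 0 := by
    simp [S.η_ξ]
  have h := hS.val_nablaφ_eq_zero hκ (hor u) (hor v) (hor w)
  have h1 := S.nablaφ_skew p u v (S.ξ p)
  simp only [map_sub, map_smul, S.nablaφ_ξ_left, S.nablaφ_ξ, sub_apply, smul_apply,
    map_neg, neg_apply, smul_eq_mul, smul_zero, sub_zero] at h h1 ⊢
  rw [h1] at h
  simp only [S.val_ξ, S.val_ξ_left, S.η_φ] at h ⊢
  linear_combination h - S.η p w * S.g.val p (S.φ p (S.nablaξ p u)) v * S.ε_mul_ε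

theorem IsKappaMu.nablaSymξ_eq : S.nablaSymξ p u v
    = (-S.ε * S.g.val p (S.symξ p (S.nablaξ p u)) v) • S.ξ p - S.η p v • S.symξ p (S.nablaξ p u)
      + (-(S.ε * μ) * S.η p u) • S.h p v := by
  refine sub_eq_zero.1 (S.g.nondegenerate p _ fun w ↦ ?_)
  have hor : ∀ z : TangentSpace 𝓘(ℝ, E) p, S.η p (z - S.η p z • S.ξ p) = 0 := by
    simp [S.η_ξ]
  have h := hS.val_nablaSymξ_horizontal hκ (hor u) (hor v) (hor w)
  have h1 := S.val_nablaSymξ_ξ p u v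
  simp only [map_sub, map_add, map_smul, hS.nablaSymξ_ξ_left, S.nablaSymξ_ξ, sub_apply, add_apply,
    smul_apply, map_neg, neg_apply, smul_eq_mul, smul_zero, sub_zero, S.h_ξ] at h h1 ⊢
  rw [h1] at h
  have h2 : S.η p (S.h p v) = 0 := by rw [S.h_eq_φ_symξ, S.η_φ]
  simp only [S.val_ξ, S.val_ξ_left, S.η_symξ, h2] at h ⊢
  linear_combination h + S.η p w * S.g.val p (S.symξ p (S.nablaξ p u)) v * S.ε_mul_ε

end KappaMu

end ContactPseudoMetric

end Symmetric

/-! ### Commutators of the curvature with `φ` and `B`. -/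

section Commutators

variable {E : Type*} [NormedAddCommGroup E] [NormedSpace ℝ E] [FiniteDimensional ℝ E]
  {M : Type*} [TopologicalSpace M] [ChartedSpace E M] [IsManifold 𝓘(ℝ, E) ∞ M]

namespace ContactPseudoMetric

variable {S : ContactPseudoMetric E M} {p : M} {x y z w : TangentSpace 𝓘(ℝ, E) p}
  {T Q U : ∀ x : M, TangentSpace 𝓘(ℝ, E) x →L[ℝ] TangentSpace 𝓘(ℝ, E) x}

/-- The Ricci identity for a field of endomorphisms `T` whose covariant derivative is
`(∇_u T) v = s g(Q u, v) ξ - η(v) Q u + c η(u) U v`, on horizontal vectors. -/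
theorem val_riemann_commutator (hT : ∀ q, EndMDiffAt T q)
    (hTs : ∀ Z : Π x : M, TangentSpace 𝓘(ℝ, E) x, CMDiffAt ∞ (T% Z) p →
      CMDiffAt ∞ (T% (fun q ↦ T q (Z q))) p)
    (hQ : EndMDiffAt Q p) (hU : EndMDiffAt U p) {s c : ℝ}
    (hform : ∀ q u v, S.g.nablaEnd (hT q) u v
      = (s * S.g.val q (Q q u) v) • S.ξ q - S.η q v • Q q u + (c * S.η q u) • U q v)
    (hx : S.η p x = 0) (hy : S.η p y = 0) (hz : S.η p z = 0) (hw : S.η p w = 0) :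
    S.g.val p (S.g.riemann p x y (T p z)) w - S.g.val p (T p (S.g.riemann p x y z)) w
      = s * (S.g.val p (Q p y) z * S.g.val p (S.nablaξ p x) w
          - S.g.val p (Q p x) z * S.g.val p (S.nablaξ p y) w)
        - S.ε * (S.g.val p (S.nablaξ p x) z * S.g.val p (Q p y) w
          - S.g.val p (S.nablaξ p y) z * S.g.val p (Q p x) w)
        + 2 * c * S.g.val p x (S.φ p y) * S.g.val p (U p z) w := by
  have md : ∀ {X : Π x : M, TangentSpace 𝓘(ℝ, E) x}, CMDiffAt ∞ (T% X) p →
      MDiffAt (T% X) p := fun h ↦ h.mdifferentiableAt (by simp)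
  have hξ := S.mdifferentiableAt_ξ p
  have key : ∀ {X Y Z : Π x : M, TangentSpace 𝓘(ℝ, E) x}, CMDiffAt ∞ (T% X) p →
      CMDiffAt ∞ (T% Y) p → CMDiffAt ∞ (T% Z) p → S.η p (X p) = 0 → S.η p (Y p) = 0 →
      S.η p (Z p) = 0 →
      S.g.val p (S.g.nabla X (S.g.nabla Y (fun q ↦ T q (Z q))) p) w
          - S.g.val p (T p (S.g.nabla X (S.g.nabla Y Z) p)) w
        = s * S.g.val p (Q p (Y p)) (Z p) * S.g.val p (S.nablaξ p (X p)) w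
          - (S.ε * S.g.val p (S.nablaξ p (X p)) (Z p) + S.η p (S.g.nabla X Z p))
            * S.g.val p (Q p (Y p)) w
          + c * (S.ε * S.g.val p (S.nablaξ p (X p)) (Y p) + S.η p (S.g.nabla X Y p))
            * S.g.val p (U p (Z p)) w
          - S.η p (S.g.nabla Y Z p) * S.g.val p (Q p (X p)) w := by
    intro X Y Z hX hY hZ hx hy hz
    have hYZ := S.g.nabla_smooth hY hZ
    let QY : Π x : M, TangentSpace 𝓘(ℝ, E) x := fun q ↦ Q q (Y q)
    let UZ : Π x : M, TangentSpace 𝓘(ℝ, E) x := fun q ↦ U q (Z q)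
    let TYZ : Π x : M, TangentSpace 𝓘(ℝ, E) x := fun q ↦ T q (S.g.nabla Y Z q)
    have hQY : MDiffAt (T% QY) p := hQ _ (md hY)
    have hUZ : MDiffAt (T% UZ) p := hU _ (md hZ)
    have hf₁ : MDifferentiableAt 𝓘(ℝ, E) 𝓘(ℝ, ℝ)
        ((fun _ ↦ s) * S.g.pair QY Z) p :=
      mdifferentiableAt_const.mul (S.g.pair_mdiff hQY (md hZ))
    have hf₂ := S.mdifferentiableAt_η (md hZ)
    have hf₃ : MDifferentiableAt 𝓘(ℝ, E) 𝓘(ℝ, ℝ) ((fun _ ↦ c) * fun q ↦ S.η q (Y q)) p :=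
      mdifferentiableAt_const.mul (S.mdifferentiableAt_η (md hY))
    have hd : dirDeriv X ((fun _ ↦ c) * fun q ↦ S.η q (Y q)) p
        = c * dirDeriv X (fun q ↦ S.η q (Y q)) p := by
      simp only [dirDeriv, mvfderiv_mul mdifferentiableAt_const (S.mdifferentiableAt_η (md hY)),
        mvfderiv_const]
      simp
    let N : Π x : M, TangentSpace 𝓘(ℝ, E) x :=
      ((fun _ ↦ s) * S.g.pair QY Z) • S.ξ - (fun q ↦ S.η q (Z q)) • QY
          + ((fun _ ↦ c) * fun q ↦ S.η q (Y q)) • UZ + TYZ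
    -- The formula for `∇T` is differentiated once more, so it is needed on a neighbourhood of `p`
    -- and not only at `p`.
    have e : S.g.nabla Y (fun q ↦ T q (Z q)) =ᶠ[𝓝 p] N := by
      filter_upwards [eventually_mdifferentiableAt hY, eventually_mdifferentiableAt hZ]
        with q h1 h2
      rw [PseudoMetric.nabla_end (hT q) h1 h2, hform]
      rfl
    have d₁ := hf₁.smul_section hξ
    have d₂ := hf₂.smul_section hQY
    have d₃ := hf₃.smul_section hUZ
    have d₄ : MDiffAt (T% TYZ) p := hT p _ (md hYZ)
    have d₁₂ := mdifferentiableAt_sub_section d₁ d₂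
    rw [PseudoMetric.nabla_congr (md (S.g.nabla_smooth hY (hTs Z hZ))) e]
    simp only [N]
    rw [PseudoMetric.nabla_add (mdifferentiableAt_add_section d₁₂ d₃) d₄,
      PseudoMetric.nabla_add d₁₂ d₃, PseudoMetric.nabla_sub d₁ d₂,
      PseudoMetric.nabla_smul hf₁ hξ, PseudoMetric.nabla_smul hf₂ hQY,
      PseudoMetric.nabla_smul hf₃ hUZ, show TYZ = fun q ↦ T q (S.g.nabla Y Z q) from rfl,
      PseudoMetric.nabla_end (hT p) (md hX) (md hYZ), hform, hd,
      S.dirDeriv_η (md hX) (md hZ), S.dirDeriv_η (md hX) (md hY), nabla_ξ]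
    simp only [map_add, map_sub, map_smul, add_apply, sub_apply, smul_apply, smul_eq_mul,
      S.val_ξ_left, hw, hx, hy, hz, Pi.mul_apply, PseudoMetric.pair, QY, UZ]
    ring
  have hX := smooth_extend x
  have hY := smooth_extend y
  have hZ := smooth_extend z
  have ex : FiberBundle.extend E x p = x := by simp
  have ey : FiberBundle.extend E y p = y := by simp
  have ez : FiberBundle.extend E z p = z := by simp
  have k₁ := key hX hY hZ (by rwa [ex]) (by rwa [ey]) (by rwa [ez])
  have k₂ := key hY hX hZ (by rwa [ey]) (by rwa [ex]) (by rwa [ez])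
  have hb := md (mlieBracket_smooth hX hY)
  have k₃ := PseudoMetric.nabla_end (g := S.g) (hT p) hb (md hZ)
  have k₄ := S.g.curvature_eq_riemann hX hY (hTs _ hZ)
  have k₅ := S.g.curvature_eq_riemann hX hY hZ
  have k₆ := S.nablaξ_skew p x y
  rw [hform] at k₃
  rw [ex, ey, ez] at *
  rw [← k₄, ← k₅]
  simp only [PseudoMetric.curvature_apply, map_sub, sub_apply]
  rw [k₃, PseudoMetric.torsion_free (g := S.g) (md hX) (md hY)]
  simp only [map_sub, map_add, map_smul, add_apply, sub_apply, smul_apply, smul_eq_mul,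
    S.val_ξ_left, hw, hz]
  -- In the `U` term, `η(∇_X Y) - η(∇_Y X)` cancels against `η([X, Y])`; what is left is the skew
  -- part of `∇ξ`, which produces `g(x, φy)`.
  linear_combination k₁ - k₂ + c * S.ε * S.g.val p (U p z) w * k₆
    + 2 * c * S.g.val p x (S.φ p y) * S.g.val p (U p z) w * S.ε_mul_ε

variable {κ μ : ℝ} (hS : S.IsKappaMu κ μ) (hκ : S.ε * κ < 1)

include hS hκ

theorem IsKappaMu.val_riemann_φ
    (hx : S.η p x = 0) (hy : S.η p y = 0) (hz : S.η p z = 0) (hw : S.η p w = 0) :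
    S.g.val p (S.g.riemann p x y (S.φ p z)) w - S.g.val p (S.φ p (S.g.riemann p x y z)) w
      = S.ε * (S.g.val p (S.φ p (S.nablaξ p y)) z * S.g.val p (S.nablaξ p x) w
          - S.g.val p (S.φ p (S.nablaξ p x)) z * S.g.val p (S.nablaξ p y) w)
        - S.ε * (S.g.val p (S.nablaξ p x) z * S.g.val p (S.φ p (S.nablaξ p y)) w
          - S.g.val p (S.nablaξ p y) z * S.g.val p (S.φ p (S.nablaξ p x)) w) := by
  have h := val_riemann_commutator (S := S) (T := S.φ) (Q := fun q ↦ S.φ q ∘L S.nablaξ q)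
    (U := S.φ) (s := S.ε) (c := 0) S.endMDiffAt_φ (fun Z hZ ↦ S.φField_smooth hZ)
    ((S.endMDiffAt_φ p).comp (S.endMDiffAt_nablaξ p)) (S.endMDiffAt_φ p)
    (fun q u v ↦ (hS.nablaφ_eq q u v hκ).trans (by simp)) hx hy hz hw
  simpa using h

theorem IsKappaMu.val_riemann_symξ
    (hx : S.η p x = 0) (hy : S.η p y = 0) (hz : S.η p z = 0) (hw : S.η p w = 0) :
    S.g.val p (S.g.riemann p x y (S.symξ p z)) w - S.g.val p (S.symξ p (S.g.riemann p x y z)) w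
      = -S.ε * (S.g.val p (S.symξ p (S.nablaξ p y)) z * S.g.val p (S.nablaξ p x) w
          - S.g.val p (S.symξ p (S.nablaξ p x)) z * S.g.val p (S.nablaξ p y) w)
        - S.ε * (S.g.val p (S.nablaξ p x) z * S.g.val p (S.symξ p (S.nablaξ p y)) w
          - S.g.val p (S.nablaξ p y) z * S.g.val p (S.symξ p (S.nablaξ p x)) w)
        + 2 * -(S.ε * μ) * S.g.val p x (S.φ p y) * S.g.val p (S.h p z) w :=
  val_riemann_commutator (S := S) (T := S.symξ) (Q := fun q ↦ S.symξ q ∘L S.nablaξ q)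
    (U := S.h) (s := -S.ε) (c := -(S.ε * μ)) S.endMDiffAt_symξ (fun Z hZ ↦ S.symξ_smooth hZ)
    ((S.endMDiffAt_symξ p).comp (S.endMDiffAt_nablaξ p))
    (by
      rw [show S.h = fun q ↦ S.φ q ∘L S.symξ q from
        funext fun q ↦ ContinuousLinearMap.ext fun u ↦ S.h_eq_φ_symξ q u]
      exact (S.endMDiffAt_φ p).comp (S.endMDiffAt_symξ p))
    (fun q u v ↦ hS.nablaSymξ_eq q u v hκ) hx hy hz hw

end ContactPseudoMetric

end Commutators

/-! ### Curvature components on the eigen-distributions of `h`. -/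

section EigenDistributions

variable {E : Type*} [NormedAddCommGroup E] [NormedSpace ℝ E] [FiniteDimensional ℝ E]
  {M : Type*} [TopologicalSpace M] [ChartedSpace E M] [IsManifold 𝓘(ℝ, E) ∞ M]

namespace ContactPseudoMetric

variable {S : ContactPseudoMetric E M} {p : M} {x y z w : TangentSpace 𝓘(ℝ, E) p} {a b c d ℓ : ℝ}

theorem h_of_mem (hx : x ∈ S.eigenDist a p) : S.h p x = a • x :=
  Module.End.mem_eigenspace_iff.1 hx

theorem mem_eigenDist (hx : S.h p x = a • x) : x ∈ S.eigenDist a p :=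
  Module.End.mem_eigenspace_iff.2 hx

theorem η_h : S.η p (S.h p x) = 0 := by rw [S.h_eq_φ_symξ, S.η_φ]

theorem h_symm : S.g.val p (S.h p x) y = S.g.val p (S.h p y) x := by
  have h := S.symξ_symm p x (S.φ p y)
  have h' := S.φ_skew p (S.symξ p x) y
  rw [S.symξ_φ] at h
  simp only [map_neg, neg_apply] at h
  rw [S.g.symm p (S.φ p y)] at h'
  rw [S.h_eq_φ_symξ, S.h_eq_φ_symξ]
  linarith

theorem h_φ : S.h p (S.φ p x) = -S.φ p (S.h p x) := by
  simp only [S.h_eq_φ_symξ, S.symξ_φ, map_neg]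

theorem η_of_mem (ha : a ≠ 0) (hx : x ∈ S.eigenDist a p) : S.η p x = 0 := by
  have h := η_h (S := S) (x := x)
  rw [h_of_mem hx, map_smul] at h
  simpa [ha] using h

theorem φ_mem_eigenDist (hx : x ∈ S.eigenDist a p) : S.φ p x ∈ S.eigenDist (-a) p := by
  apply mem_eigenDist
  rw [h_φ, h_of_mem hx, map_smul, neg_smul]

/-- Inverts `h = φB`: as `Bx` is horizontal, `Bx = -φ²Bx = -φhx`. All terms of the commutators thus
become multiples of `x` or `φx`. -/
theorem symξ_of_mem (hx : x ∈ S.eigenDist a p) : S.symξ p x = -a • S.φ p x := by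
  have h := S.φ_sq p (S.symξ p x)
  rw [← S.h_eq_φ_symξ, h_of_mem hx, S.η_symξ, map_smul] at h
  linear_combination (norm := module) h

theorem nablaξ_of_mem (hx : x ∈ S.eigenDist a p) : S.nablaξ p x = -(a + S.ε) • S.φ p x := by
  rw [S.nablaξ_apply, symξ_of_mem hx]
  module

theorem φ_nablaξ_of_mem (ha : a ≠ 0) (hx : x ∈ S.eigenDist a p) :
    S.φ p (S.nablaξ p x) = (a + S.ε) • x := by
  rw [nablaξ_of_mem hx, map_smul, S.φ_sq, η_of_mem ha hx]
  module

theorem symξ_nablaξ_of_mem (hx : x ∈ S.eigenDist a p) :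
    S.symξ p (S.nablaξ p x) = ((a + S.ε) * a) • x := by
  rw [nablaξ_of_mem hx, map_smul, S.symξ_φ, ← S.h_eq_φ_symξ, h_of_mem hx]
  module

theorem val_eigenDist (hab : a ≠ b) (hx : x ∈ S.eigenDist a p) (hy : y ∈ S.eigenDist b p) :
    S.g.val p x y = 0 := by
  have h := h_symm (S := S) (x := x) (y := y)
  rw [h_of_mem hx, h_of_mem hy, S.g.symm p (b • y)] at h
  simp only [map_smul, smul_apply, smul_eq_mul] at h
  have : (a - b) * S.g.val p x y = 0 := by linarith
  exact (mul_eq_zero.1 this).resolve_left (sub_ne_zero.2 hab)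

theorem val_φ_φ (hy : S.η p y = 0) : S.g.val p (S.φ p x) (S.φ p y) = S.g.val p x y := by
  rw [S.compatible, hy]
  ring

theorem val_φ_right : S.g.val p x (S.φ p y) = -S.g.val p (S.φ p x) y := by
  rw [S.g.symm, S.φ_skew]

variable {κ μ : ℝ} (hS : S.IsKappaMu κ μ) (hκ : S.ε * κ < 1)

include hS

/-- As `h² = ℓ²` on horizontal vectors, `u ± ℓ⁻¹hu` are eigenvectors; with `ξ` the two eigenspaces
span the tangent space, and `g` is non-degenerate. -/
theorem IsKappaMu.ext_val_eigenDist (hℓ : ℓ ≠ 0) (hℓ2 : ℓ ^ 2 = 1 - S.ε * κ)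
    {v v' : TangentSpace 𝓘(ℝ, E) p} (h0 : S.g.val p v (S.ξ p) = S.g.val p v' (S.ξ p))
    (h1 : ∀ w ∈ S.eigenDist ℓ p, S.g.val p v w = S.g.val p v' w)
    (h2 : ∀ w ∈ S.eigenDist (-ℓ) p, S.g.val p v w = S.g.val p v' w) : v = v' := by
  refine sub_eq_zero.1 (S.g.nondegenerate p _ fun w ↦ ?_)
  obtain ⟨u, hu⟩ : ∃ u, u = w - S.η p w • S.ξ p := ⟨_, rfl⟩
  have hηu : S.η p u = 0 := by simp [hu, S.η_ξ]
  have hhu : S.h p (S.h p u) = ℓ ^ 2 • u := by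
    rw [S.h_eq_φ_symξ, S.h_eq_φ_symξ, S.symξ_φ, map_neg, S.φ_sq, S.η_symξ, hS.symξ_symξ, S.φ_sq,
      hηu, hℓ2]
    module
  have e₁ : u + ℓ⁻¹ • S.h p u ∈ S.eigenDist ℓ p := by
    apply mem_eigenDist
    rw [map_add, map_smul, hhu, smul_add, smul_smul, smul_smul,
      show ℓ⁻¹ * ℓ ^ 2 = ℓ by field_simp, mul_inv_cancel₀ hℓ]
    module
  have e₂ : u - ℓ⁻¹ • S.h p u ∈ S.eigenDist (-ℓ) p := by
    apply mem_eigenDist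
    rw [map_sub, map_smul, hhu, smul_sub (-ℓ), smul_smul, smul_smul,
      show ℓ⁻¹ * ℓ ^ 2 = ℓ by field_simp, neg_mul, mul_inv_cancel₀ hℓ]
    module
  have hw : w = S.η p w • S.ξ p + (1 / 2 : ℝ) • ((u + ℓ⁻¹ • S.h p u) + (u - ℓ⁻¹ • S.h p u)) := by
    rw [hu]
    module
  have k₁ := h1 _ e₁
  have k₂ := h2 _ e₂
  rw [hw, map_sub, sub_apply, map_add, map_smul, map_smul, map_add, h0, k₁, k₂, ← map_add,
    ← map_smul, ← map_smul, ← map_add, sub_self]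

theorem IsKappaMu.val_riemann_right_ξ (hx : S.η p x = 0) (hy : S.η p y = 0) :
    S.g.val p (S.g.riemann p x y z) (S.ξ p) = 0 := by
  rw [S.g.val_riemann_skew, hS.riemann_ξ, hx, hy]
  simp

include hκ

/-- From `h = φB`, `[R, h] = [R, φ]B + φ[R, B]`: the `φ` commutator is taken at `Bz`, the `B`
commutator is paired with `φw`. -/
theorem IsKappaMu.val_riemann_h
    (hx : S.η p x = 0) (hy : S.η p y = 0) (hz : S.η p z = 0) (hw : S.η p w = 0) :
    S.g.val p (S.g.riemann p x y (S.h p z)) w - S.g.val p (S.g.riemann p x y z) (S.h p w)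
      = S.ε * (S.g.val p (S.φ p (S.nablaξ p y)) (S.symξ p z) * S.g.val p (S.nablaξ p x) w
          - S.g.val p (S.φ p (S.nablaξ p x)) (S.symξ p z) * S.g.val p (S.nablaξ p y) w)
        - S.ε * (S.g.val p (S.nablaξ p x) (S.symξ p z) * S.g.val p (S.φ p (S.nablaξ p y)) w
          - S.g.val p (S.nablaξ p y) (S.symξ p z) * S.g.val p (S.φ p (S.nablaξ p x)) w)
        - (-S.ε * (S.g.val p (S.symξ p (S.nablaξ p y)) z * S.g.val p (S.nablaξ p x) (S.φ p w)
          - S.g.val p (S.symξ p (S.nablaξ p x)) z * S.g.val p (S.nablaξ p y) (S.φ p w))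
        - S.ε * (S.g.val p (S.nablaξ p x) z * S.g.val p (S.symξ p (S.nablaξ p y)) (S.φ p w)
          - S.g.val p (S.nablaξ p y) z * S.g.val p (S.symξ p (S.nablaξ p x)) (S.φ p w))
        + 2 * -(S.ε * μ) * S.g.val p x (S.φ p y) * S.g.val p (S.h p z) (S.φ p w)) := by
  have h₁ := hS.val_riemann_φ hκ hx hy (S.η_symξ p z) hw
  have h₂ := hS.val_riemann_symξ hκ hx hy hz (S.η_φ p w)
  rw [S.φ_skew, S.g.symm p (S.φ p w), ← S.h_eq_φ_symξ] at h₁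
  rw [S.symξ_symm, S.symξ_φ, map_neg, neg_apply, ← S.h_eq_φ_symξ, S.g.symm p (S.h p w)] at h₂
  linear_combination h₁ - h₂

theorem IsKappaMu.val_riemann_eigenDist (ha : a ≠ 0) (hb : b ≠ 0) (hc : c ≠ 0) (hd : d ≠ 0)
    (hx : x ∈ S.eigenDist a p) (hy : y ∈ S.eigenDist b p) (hz : z ∈ S.eigenDist c p)
    (hw : w ∈ S.eigenDist d p) :
    (c - d) * S.g.val p (S.g.riemann p x y z) w
      = S.ε * (a + S.ε) * (b + S.ε) *
          (c * (S.g.val p (S.φ p x) z * S.g.val p (S.φ p y) w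
              - S.g.val p (S.φ p y) z * S.g.val p (S.φ p x) w
              + S.g.val p y z * S.g.val p x w - S.g.val p x z * S.g.val p y w)
            + a * (S.g.val p x z * S.g.val p y w - S.g.val p (S.φ p y) z * S.g.val p (S.φ p x) w)
            - b * (S.g.val p y z * S.g.val p x w - S.g.val p (S.φ p x) z * S.g.val p (S.φ p y) w))
        + 2 * S.ε * μ * c * S.g.val p (S.φ p x) y * S.g.val p (S.φ p z) w := by
  have h := hS.val_riemann_h hκ (η_of_mem ha hx) (η_of_mem hb hy) (η_of_mem hc hz) (η_of_mem hd hw)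
  rw [h_of_mem hz, h_of_mem hw, symξ_nablaξ_of_mem hx, symξ_nablaξ_of_mem hy,
    φ_nablaξ_of_mem ha hx, φ_nablaξ_of_mem hb hy, nablaξ_of_mem hx, nablaξ_of_mem hy,
    symξ_of_mem hz, S.g.riemann_smul_right] at h
  simp only [map_smul, smul_apply, smul_eq_mul, val_φ_φ (η_of_mem hc hz),
    val_φ_φ (η_of_mem hd hw), val_φ_right] at h
  linear_combination h

/-! ### The components for eigenvalues `a` and `b = -a`, either of which may be `λ`. -/

section Opposite

variable (hab : a + b = 0) (ha : a ≠ 0) (ha2 : a ^ 2 = 1 - S.ε * κ)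

omit hS hκ in
theorem φ_mem_eigenDist_opposite (hab : a + b = 0) (hx : x ∈ S.eigenDist a p) :
    S.φ p x ∈ S.eigenDist b p := by
  rw [eq_neg_of_add_eq_zero_right hab]
  exact φ_mem_eigenDist hx

omit hS hκ in
theorem val_eigenDist_opposite (hab : a + b = 0) (ha : a ≠ 0) (hx : x ∈ S.eigenDist a p)
    (hy : y ∈ S.eigenDist b p) : S.g.val p x y = 0 :=
  val_eigenDist (fun h ↦ ha (by linarith)) hx hy

omit hS hκ in
theorem opposite_swap (hab : a + b = 0) (ha : a ≠ 0) (ha2 : a ^ 2 = 1 - S.ε * κ) :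
    b + a = 0 ∧ b ≠ 0 ∧ b ^ 2 = 1 - S.ε * κ := by
  obtain rfl := eq_neg_of_add_eq_zero_right hab
  exact ⟨by ring, neg_ne_zero.2 ha, by rw [neg_sq, ha2]⟩

include hab ha ha2

theorem IsKappaMu.val_riemann_aaba (hx : x ∈ S.eigenDist a p) (hy : y ∈ S.eigenDist a p)
    (hz : z ∈ S.eigenDist b p) (hw : w ∈ S.eigenDist a p) :
    S.g.val p (S.g.riemann p x y z) w = 0 := by
  obtain ⟨hba, hb, -⟩ := opposite_swap hab ha ha2
  have h := hS.val_riemann_eigenDist hκ ha ha hb ha hx hy hz hw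
  rw [val_eigenDist_opposite hab ha hx hz, val_eigenDist_opposite hab ha hy hz,
    val_eigenDist_opposite hba hb (φ_mem_eigenDist_opposite hab hx) hw,
    val_eigenDist_opposite hba hb (φ_mem_eigenDist_opposite hab hy) hw,
    val_eigenDist_opposite hba hb (φ_mem_eigenDist_opposite hab hx) hy] at h
  have h' : (b - a) * S.g.val p (S.g.riemann p x y z) w = 0 := by linear_combination h
  exact (mul_eq_zero.1 h').resolve_left fun h ↦ ha (by linarith)

theorem IsKappaMu.val_riemann_aaab (hx : x ∈ S.eigenDist a p) (hy : y ∈ S.eigenDist a p)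
    (hz : z ∈ S.eigenDist a p) (hw : w ∈ S.eigenDist b p) :
    S.g.val p (S.g.riemann p x y z) w = 0 := by
  rw [S.g.val_riemann_skew, hS.val_riemann_aaba hκ hab ha ha2 hx hy hw hz, neg_zero]

theorem IsKappaMu.val_riemann_abaa (hx : x ∈ S.eigenDist a p) (hy : y ∈ S.eigenDist b p)
    (hz : z ∈ S.eigenDist a p) (hw : w ∈ S.eigenDist a p) :
    S.g.val p (S.g.riemann p x y z) w = 0 := by
  rw [S.g.val_riemann_pair_symm, S.g.riemann_skew, map_neg, neg_apply,
    hS.val_riemann_aaab hκ hab ha ha2 hw hz hx hy, neg_zero]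

theorem IsKappaMu.val_riemann_abab (hx : x ∈ S.eigenDist a p) (hy : y ∈ S.eigenDist b p)
    (hz : z ∈ S.eigenDist a p) (hw : w ∈ S.eigenDist b p) :
    S.g.val p (S.g.riemann p x y z) w
      = -κ * S.g.val p (S.φ p y) z * S.g.val p (S.φ p x) w
        - S.ε * μ * S.g.val p (S.φ p y) x * S.g.val p (S.φ p z) w := by
  obtain ⟨hba, hb, -⟩ := opposite_swap hab ha ha2
  have h := hS.val_riemann_eigenDist hκ ha hb ha hb hx hy hz hw
  rw [val_eigenDist_opposite hba hb hy hz, val_eigenDist_opposite hab ha hx hw,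
    val_eigenDist_opposite hba hb (φ_mem_eigenDist_opposite hab hx) hz,
    val_eigenDist_opposite hab ha (φ_mem_eigenDist_opposite hba hy) hw,
    S.φ_skew p x y] at h
  obtain rfl := eq_neg_of_add_eq_zero_right hab
  refine mul_left_cancel₀ (mul_ne_zero two_ne_zero ha) ?_
  have hε := S.ε_mul_ε
  -- The factor `ε(a + ε)(b + ε)` equals `ε(1 - a²) = κ`, since `b = -a`.
  linear_combination h - 2 * a * S.g.val p (S.φ p y) z * S.g.val p (S.φ p x) w *
    ((S.ε + κ) * hε - S.ε * ha2)

/-- Here `z` and `w` share an eigenvalue and the commutator with `h` gives nothing; Bianchi rewrites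
the component through two of the type `abab`. -/
theorem IsKappaMu.val_riemann_aabb (hx : x ∈ S.eigenDist a p) (hy : y ∈ S.eigenDist a p)
    (hz : z ∈ S.eigenDist b p) (hw : w ∈ S.eigenDist b p) :
    S.g.val p (S.g.riemann p x y z) w
      = (κ - S.ε * μ) * (S.g.val p (S.φ p y) z * S.g.val p (S.φ p x) w
        - S.g.val p (S.φ p x) z * S.g.val p (S.φ p y) w) := by
  have h := congrArg (fun v ↦ S.g.val p v w) (S.g.riemann_bianchi x y z)
  have h₁ := hS.val_riemann_abab hκ hab ha ha2 hy hz hx hw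
  have h₂ := hS.val_riemann_abab hκ hab ha ha2 hx hz hy hw
  rw [S.g.riemann_skew z x] at h
  simp only [map_add, map_neg, add_apply, neg_apply, map_zero, zero_apply] at h
  rw [S.φ_skew p z x, S.φ_skew p z y] at h₁ h₂
  linear_combination h - h₁ + h₂

/-- The commutator with `φ`, paired with `φw`, compares `g(R(x, y)z, w)` with `g(R(x, y)φz, φw)`,
which is of the type `aabb`. -/
theorem IsKappaMu.val_riemann_aaaa (hx : x ∈ S.eigenDist a p) (hy : y ∈ S.eigenDist a p)
    (hz : z ∈ S.eigenDist a p) (hw : w ∈ S.eigenDist a p) :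
    S.g.val p (S.g.riemann p x y z) w
      = (2 * (S.ε + a) - S.ε * μ) * (S.g.val p y z * S.g.val p x w
        - S.g.val p x z * S.g.val p y w) := by
  obtain ⟨hba, hb, -⟩ := opposite_swap hab ha ha2
  have hφw := φ_mem_eigenDist_opposite hab hw
  have h := hS.val_riemann_φ hκ (η_of_mem ha hx) (η_of_mem ha hy) (η_of_mem ha hz)
    (η_of_mem hb hφw)
  rw [hS.val_riemann_aabb hκ hab ha ha2 hx hy (φ_mem_eigenDist_opposite hab hz) hφw,
    φ_nablaξ_of_mem ha hx, φ_nablaξ_of_mem ha hy, nablaξ_of_mem hx, nablaξ_of_mem hy,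
    val_φ_φ (η_of_mem ha hw)] at h
  simp only [map_smul, smul_apply, smul_eq_mul, val_φ_φ (η_of_mem ha hz),
    val_φ_φ (η_of_mem ha hw)] at h
  rw [val_eigenDist_opposite hab ha hx hφw, val_eigenDist_opposite hab ha hy hφw] at h
  have hε := S.ε_mul_ε
  -- Eliminating `κ` lets the coefficient `(κ - εμ) + ε(a + ε)²` simplify to `2(ε + a) - εμ`.
  have hκ' : κ = S.ε * (1 - a ^ 2) := by linear_combination -κ * hε + S.ε * ha2
  rw [hκ'] at h
  linear_combination -h + (2 * a + S.ε) * (S.g.val p y z * S.g.val p x w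
    - S.g.val p x z * S.g.val p y w) * hε

theorem IsKappaMu.riemann_aab (hx : x ∈ S.eigenDist a p) (hy : y ∈ S.eigenDist a p)
    (hz : z ∈ S.eigenDist b p) :
    S.g.riemann p x y z = (κ - S.ε * μ) • (S.g.val p (S.φ p y) z • S.φ p x
      - S.g.val p (S.φ p x) z • S.φ p y) := by
  obtain ⟨hba, hb, -⟩ := opposite_swap hab ha ha2
  refine hS.ext_val_eigenDist ha ha2 ?_ (fun w hw ↦ ?_) (fun w hw ↦ ?_)
  · rw [hS.val_riemann_right_ξ (η_of_mem ha hx) (η_of_mem ha hy)]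
    simp [S.val_ξ, S.η_φ]
  · rw [hS.val_riemann_aaba hκ hab ha ha2 hx hy hz hw]
    simp [val_eigenDist_opposite hba hb (φ_mem_eigenDist_opposite hab hx) hw,
      val_eigenDist_opposite hba hb (φ_mem_eigenDist_opposite hab hy) hw]
  · rw [← eq_neg_of_add_eq_zero_right hab] at hw
    rw [hS.val_riemann_aabb hκ hab ha ha2 hx hy hz hw]
    simp

theorem IsKappaMu.riemann_aba (hx : x ∈ S.eigenDist a p) (hy : y ∈ S.eigenDist b p)
    (hz : z ∈ S.eigenDist a p) :
    S.g.riemann p x y z = -(κ * S.g.val p (S.φ p y) z) • S.φ p x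
      - (S.ε * μ * S.g.val p (S.φ p y) x) • S.φ p z := by
  obtain ⟨hba, hb, -⟩ := opposite_swap hab ha ha2
  refine hS.ext_val_eigenDist ha ha2 ?_ (fun w hw ↦ ?_) (fun w hw ↦ ?_)
  · rw [hS.val_riemann_right_ξ (η_of_mem ha hx) (η_of_mem hb hy)]
    simp [S.val_ξ, S.η_φ]
  · rw [hS.val_riemann_abaa hκ hab ha ha2 hx hy hz hw]
    simp [val_eigenDist_opposite hba hb (φ_mem_eigenDist_opposite hab hx) hw,
      val_eigenDist_opposite hba hb (φ_mem_eigenDist_opposite hab hz) hw]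
  · rw [← eq_neg_of_add_eq_zero_right hab] at hw
    rw [hS.val_riemann_abab hκ hab ha ha2 hx hy hz hw]
    simp

theorem IsKappaMu.riemann_baa (hx : x ∈ S.eigenDist b p) (hy : y ∈ S.eigenDist a p)
    (hz : z ∈ S.eigenDist a p) :
    S.g.riemann p x y z = (κ * S.g.val p (S.φ p x) z) • S.φ p y
      + (S.ε * μ * S.g.val p (S.φ p x) y) • S.φ p z := by
  rw [S.g.riemann_skew, hS.riemann_aba hκ hab ha ha2 hy hx hz]
  module

theorem IsKappaMu.riemann_aaa (hx : x ∈ S.eigenDist a p) (hy : y ∈ S.eigenDist a p)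
    (hz : z ∈ S.eigenDist a p) :
    S.g.riemann p x y z = (2 * (S.ε + a) - S.ε * μ) • (S.g.val p y z • x
      - S.g.val p x z • y) := by
  refine hS.ext_val_eigenDist ha ha2 ?_ (fun w hw ↦ ?_) (fun w hw ↦ ?_)
  · rw [hS.val_riemann_right_ξ (η_of_mem ha hx) (η_of_mem ha hy)]
    simp [S.val_ξ, η_of_mem ha hx, η_of_mem ha hy]
  · rw [hS.val_riemann_aaaa hκ hab ha ha2 hx hy hz hw]
    simp
  · rw [← eq_neg_of_add_eq_zero_right hab] at hw
    rw [hS.val_riemann_aaab hκ hab ha ha2 hx hy hz hw]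
    simp [val_eigenDist_opposite hab ha hx hw, val_eigenDist_opposite hab ha hy hw]

end Opposite

end ContactPseudoMetric

end EigenDistributions

end ContactPM

end

theorem theorem049 {E : Type*} [NormedAddCommGroup E] [NormedSpace ℝ E] [FiniteDimensional ℝ E]
    {M : Type*} [TopologicalSpace M] [ChartedSpace E M] [IsManifold 𝓘(ℝ, E) ∞ M]
    (n : ℕ) (hn : Module.finrank ℝ E = 2 * n + 1)
    (S : ContactPM.ContactPseudoMetric E M) (κ μ : ℝ) (hS : S.IsKappaMu κ μ) (hκ : S.ε * κ < 1)
    (lam : ℝ) (hlam : lam = Real.sqrt (1 - S.ε * κ))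
    (p : M) (Xp Yp Zp Xm Ym Zm : Π x : M, TangentSpace 𝓘(ℝ, E) x)
    (hXp : CMDiffAt ∞ (T% Xp) p) (hYp : CMDiffAt ∞ (T% Yp) p) (hZp : CMDiffAt ∞ (T% Zp) p)
    (hXm : CMDiffAt ∞ (T% Xm) p) (hYm : CMDiffAt ∞ (T% Ym) p) (hZm : CMDiffAt ∞ (T% Zm) p)
    (eXp : Xp p ∈ S.eigenDist lam p) (eYp : Yp p ∈ S.eigenDist lam p)
    (eZp : Zp p ∈ S.eigenDist lam p) (eXm : Xm p ∈ S.eigenDist (-lam) p)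
    (eYm : Ym p ∈ S.eigenDist (-lam) p) (eZm : Zm p ∈ S.eigenDist (-lam) p) :
    S.g.curvature Xp Yp Zm p =
        (κ - S.ε * μ) • (S.g.val p (S.φ p (Yp p)) (Zm p) • S.φ p (Xp p)
          - S.g.val p (S.φ p (Xp p)) (Zm p) • S.φ p (Yp p)) ∧
    S.g.curvature Xm Ym Zp p =
        (κ - S.ε * μ) • (S.g.val p (S.φ p (Ym p)) (Zp p) • S.φ p (Xm p)
          - S.g.val p (S.φ p (Xm p)) (Zp p) • S.φ p (Ym p)) ∧
    S.g.curvature Xm Yp Zm p =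
        -(κ * S.g.val p (S.φ p (Yp p)) (Zm p)) • S.φ p (Xm p)
          - (S.ε * μ * S.g.val p (S.φ p (Yp p)) (Xm p)) • S.φ p (Zm p) ∧
    S.g.curvature Xm Yp Zp p =
        (κ * S.g.val p (S.φ p (Xm p)) (Zp p)) • S.φ p (Yp p)
          + (S.ε * μ * S.g.val p (S.φ p (Xm p)) (Yp p)) • S.φ p (Zp p) ∧
    S.g.curvature Xp Yp Zp p =
        (2 * (S.ε + lam) - S.ε * μ) • (S.g.val p (Yp p) (Zp p) • Xp p
          - S.g.val p (Xp p) (Zp p) • Yp p) ∧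
    S.g.curvature Xm Ym Zm p =
        (2 * (S.ε - lam) - S.ε * μ) • (S.g.val p (Ym p) (Zm p) • Xm p
          - S.g.val p (Xm p) (Zm p) • Ym p) := by
  have hpos : 0 < 1 - S.ε * κ := sub_pos.2 hκ
  have hl : lam ≠ 0 := hlam ▸ (Real.sqrt_pos.2 hpos).ne'
  have hl2 : lam ^ 2 = 1 - S.ε * κ := hlam ▸ Real.sq_sqrt hpos.le
  have hab : lam + -lam = 0 := add_neg_cancel lam
  obtain ⟨hba, hm, hm2⟩ := ContactPM.ContactPseudoMetric.opposite_swap hab hl hl2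
  rw [S.g.curvature_eq_riemann hXp hYp hZm, S.g.curvature_eq_riemann hXm hYm hZp,
    S.g.curvature_eq_riemann hXm hYp hZm, S.g.curvature_eq_riemann hXm hYp hZp,
    S.g.curvature_eq_riemann hXp hYp hZp, S.g.curvature_eq_riemann hXm hYm hZm]
  -- The second, third and sixth formulas use the roles `a = -λ`, `b = λ`; the others use `a = λ`,
  -- `b = -λ`.
  exact ⟨hS.riemann_aab hκ hab hl hl2 eXp eYp eZm, hS.riemann_aab hκ hba hm hm2 eXm eYm eZp,
    hS.riemann_aba hκ hba hm hm2 eXm eYp eZm, hS.riemann_baa hκ hab hl hl2 eXm eYp eZp,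
    hS.riemann_aaa hκ hab hl hl2 eXp eYp eZp, hS.riemann_aaa hκ hba hm hm2 eXm eYm eZm⟩
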